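/- Let $M$ be a von Neumann algebra with a normal finite faithful trace $\tau$. Let $L_2(M)$ be the completion of $M$ for $\|a\|_2=\tau(a^*a)^{1/2}$, identified with a space of (possibly unbounded) operators affiliated with $M$. Let $(T_t)_{t>0}$ be a symmetric positive contraction semigroup on $M$. This means that the $T_t$ are linear maps $M\to M$ with $T_{s+t}=T_sT_t$ such that, for all $t>0$, $\|T_ta\|\le\|a\|$ for $a\in M$; $\tau(T_ta)\le\tau(a)$ and $T_ta\ge0$ for $a\ge 0$; $\tau(T_t(b)^*a)=\tau(b^*T_t(a))$ for $a,b\in M$; and $T_ta\to a$ in the weak-* topology of $M$ as $t\to0^+$ for every $a\in M$. Denote the extensions of $T_t$ to contractions of $L_2(M)$ again by $T_t$. Let $L$ be the generator on $L_2(M)$, with $T_t=e^{-tL}$; that is, $Lx=\lim_{t\to0^+}\frac{x-T_tx}{t}$ in $L_2(M)$, and $\mathrm{Dom}(L)$ is the set of $x\in L_2(M)$ for which this limit exists. Let $x\in\mathrm{Dom}(L)$ be strictly positive, that is, positive with a bounded inverse $x^{-1}\in M$ ($x$ itself may be unbounded). Let $q\ge2$ and $\frac1q+\frac1{q^*}=1$.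 For $\zeta\in L_2(M)$ put $\tau(x^{2/q^*}\zeta)=\lim_{n\to\infty}\tau(\min(x,n)^{2/q^*}\zeta)$ whenever this limit exists (if $x$ is bounded, this is just the trace of $x^{2/q^*}\zeta$). Then $\tau\big(x^{2/q^*}(x^{2/q}-T_t(x^{2/q}))\big)$ is defined for every $t>0$, and the limit $$D=\lim_{t\to0^+}\tfrac1t\,\tau\big(x^{2/q^*}(x^{2/q}-T_t(x^{2/q}))\big)$$ exists and is real. This $D$ is the meaning of $\tau(x^{2/q^*}L(x^{2/q}))$: whenever $x^{2/q}\in\mathrm{Dom}(L)$, the trace $\tau(x^{2/q^*}L(x^{2/q}))$ is defined and equals $D$. Moreover, $$D\le\frac{q^2}{4(q-1)}\,\tau(xLx)\qquad\text{and}\qquad \tau(xLx)\le\frac{q^2}{4(q-1)}\,D .$$ -/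

import Mathlib

open Filter Topology
open scoped NNReal ComplexOrder InnerProductSpace

noncomputable section

namespace NCSemigroup

universe u

variable {M : Type u} [CStarAlgebra M] [PartialOrder M] [StarOrderedRing M]

/-- A positive functional is normal if it preserves suprema of increasing nets of positive
elements. -/
def IsNormal (ω : M →ₚ[ℂ] ℂ) : Prop :=
  ∀ (D : Set M) (s : M), D.Nonempty → DirectedOn (· ≤ ·) D → (∀ a ∈ D, 0 ≤ a) → IsLUB D s →
    IsLUB ((fun a => (ω a).re) '' D) (ω s).re

/-- `τ` is a normal faithful trace. It is finite, being defined on all of `M`. -/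
structure IsNormalFaithfulTrace (τ : M →ₚ[ℂ] ℂ) : Prop where
  normal : IsNormal τ
  faithful : ∀ a : M, τ (star a * a) = 0 → a = 0
  tracial : ∀ a b : M, τ (a * b) = τ (b * a)

/-- A symmetric positive contraction semigroup `(T_t)` on `(M, τ)`, with the convention
`T_0 = id`. -/
structure SymSemigroup (τ : M →ₚ[ℂ] ℂ) where
  /-- The operators `T_t`. -/
  T : ℝ≥0 → M →ₗ[ℂ] M
  zero' : T 0 = LinearMap.id
  add' : ∀ s t, T (s + t) = T s ∘ₗ T t
  contraction' : ∀ t a, ‖T t a‖ ≤ ‖a‖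
  trace_le' : ∀ t a, 0 ≤ a → (τ (T t a)).re ≤ (τ a).re
  positive' : ∀ t a, 0 ≤ a → 0 ≤ T t a
  symmetric' : ∀ t a b, τ (star (T t b) * a) = τ (star b * T t a)
  /-- `T_t a → a` in the weak-* topology of `M` as `t → 0⁺`; the predual of `M` is spanned by the
  normal positive functionals. -/
  weakStar_continuous' : ∀ a : M, ∀ ω : M →ₚ[ℂ] ℂ, IsNormal ω →
    Tendsto (fun t : ℝ≥0 => ω (T t a)) (𝓝[>] 0) (𝓝 (ω a))

/-- `L_2(M)`: the completion of `M` for the norm `‖a‖_2 = τ(a* a)^{1/2}`. -/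
abbrev L2 (τ : M →ₚ[ℂ] ℂ) : Type u := τ.GNS

/-- The embedding `M → L_2(M)`. -/
def emb (τ : M →ₚ[ℂ] ℂ) (a : M) : L2 τ := ((τ.toPreGNS a : τ.PreGNS) : τ.GNS)

/-- The product `a · ζ` of `a ∈ M` and `ζ ∈ L_2(M)`. -/
def lmul (τ : M →ₚ[ℂ] ℂ) (a : M) (ζ : L2 τ) : L2 τ := τ.gnsStarAlgHom a ζ

/-- The trace `τ(ζ) = ⟨1, ζ⟩` of `ζ ∈ L_2(M)`. -/
def trL2 (τ : M →ₚ[ℂ] ℂ) (ζ : L2 τ) : ℂ := ⟪emb τ 1, ζ⟫_ℂ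

lemma lmul_emb (τ : M →ₚ[ℂ] ℂ) (a c : M) : lmul τ a (emb τ c) = emb τ (a * c) := by
  simp [lmul, emb]

lemma trL2_emb (τ : M →ₚ[ℂ] ℂ) (a : M) : trL2 τ (emb τ a) = τ a := by
  simp [trL2, emb, PositiveLinearMap.preGNS_inner_def]

lemma inner_emb (τ : M →ₚ[ℂ] ℂ) (a c : M) : ⟪emb τ a, emb τ c⟫_ℂ = τ (star a * c) := by
  simp [emb, PositiveLinearMap.preGNS_inner_def]

/-! ### Extension of the semigroup to `L_2(M)` -/

lemma norm_toPreGNS_le (τ : M →ₚ[ℂ] ℂ) (a : M) :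
    ‖τ.toPreGNS a‖ ≤ ‖a‖ * ‖τ.toPreGNS 1‖ := by
  have h := (τ.leftMulMapPreGNS a).le_of_opNorm_le
    (LinearMap.mkContinuous_norm_le _ (norm_nonneg a) _) (τ.toPreGNS 1)
  simpa using h

lemma norm_map_le (τ : M →ₚ[ℂ] ℂ) (T : M →ₗ[ℂ] M) (hc : ∀ a, ‖T a‖ ≤ ‖a‖)
    (hs : ∀ a b, τ (star (T b) * a) = τ (star b * T a)) (a : M) :
    ‖τ.toPreGNS (T a)‖ ≤ ‖τ.toPreGNS a‖ := by
  have hpc : ∀ m : ℕ, ‖(T ^ m) a‖ ≤ ‖a‖ := by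
    intro m
    induction m with
    | zero => simp
    | succ k ih => rw [pow_succ']; exact (hc _).trans ih
  have hps : ∀ (m : ℕ) (b c : M), τ (star ((T ^ m) b) * c) = τ (star b * (T ^ m) c) := by
    intro m
    induction m with
    | zero => simp
    | succ k ih =>
      intro b c
      rw [pow_succ', Module.End.mul_apply, hs, ih, ← Module.End.mul_apply, ← pow_succ,
        ← pow_succ']
  have hstep : ∀ m : ℕ, ‖τ.toPreGNS ((T ^ m) a)‖ ^ 2
      ≤ ‖τ.toPreGNS a‖ * ‖τ.toPreGNS ((T ^ (m + m)) a)‖ := by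
    intro m
    have h1 : ⟪τ.toPreGNS ((T ^ m) a), τ.toPreGNS ((T ^ m) a)⟫_ℂ
        = ⟪τ.toPreGNS a, τ.toPreGNS ((T ^ (m + m)) a)⟫_ℂ := by
      rw [PositiveLinearMap.preGNS_inner_def, PositiveLinearMap.preGNS_inner_def]
      simp only [PositiveLinearMap.ofPreGNS_toPreGNS]
      rw [hps, pow_add, Module.End.mul_apply]
    have h2 := norm_inner_le_norm (𝕜 := ℂ) (τ.toPreGNS a) (τ.toPreGNS ((T ^ (m + m)) a))
    rw [← h1, inner_self_eq_norm_sq_to_K] at h2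
    simpa using h2
  set r := ‖τ.toPreGNS a‖ with hr
  have hr0 : 0 ≤ r := norm_nonneg _
  have hind : ∀ k : ℕ, ‖τ.toPreGNS (T a)‖ ^ (2 ^ k) * r
      ≤ r ^ (2 ^ k) * ‖τ.toPreGNS ((T ^ (2 ^ k)) a)‖ := by
    intro k
    induction k with
    | zero => simp [mul_comm]
    | succ k ih =>
      rcases hr0.eq_or_lt with h0 | h0
      · rw [← h0]; simp
      · have h3 := hstep (2 ^ k)
        have h4 : 2 ^ k + 2 ^ k = 2 ^ (k + 1) := by ring
        rw [h4] at h3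
        have h5 := pow_le_pow_left₀ (by positivity) ih 2
        rw [mul_pow, mul_pow, ← pow_mul, ← pow_mul, ← pow_succ] at h5
        have h6 : ‖τ.toPreGNS (T a)‖ ^ (2 ^ (k + 1)) * r ^ 2
            ≤ r ^ (2 ^ (k + 1)) * (r * ‖τ.toPreGNS ((T ^ (2 ^ (k + 1))) a)‖) :=
          h5.trans (by gcongr)
        nlinarith
  by_contra! hlt
  rcases hr0.eq_or_lt with h0 | h0
  · have h1 := hstep 1
    rw [← h0] at h1 hlt
    simp only [pow_one, zero_mul] at h1
    nlinarith
  · set C := ‖a‖ * ‖τ.toPreGNS 1‖ with hC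
    have hb : ∀ k : ℕ, (‖τ.toPreGNS (T a)‖ / r) ^ (2 ^ k) ≤ C / r := by
      intro k
      rw [div_pow, div_le_div_iff₀ (by positivity) h0]
      refine (hind k).trans ?_
      rw [mul_comm]
      gcongr
      exact (norm_toPreGNS_le τ _).trans (by rw [hC]; gcongr; exact hpc _)
    have hone : 1 < ‖τ.toPreGNS (T a)‖ / r := (one_lt_div h0).2 hlt
    obtain ⟨n, hn⟩ := pow_unbounded_of_one_lt (C / r) hone
    have := hb n
    have h7 : (‖τ.toPreGNS (T a)‖ / r) ^ n ≤ (‖τ.toPreGNS (T a)‖ / r) ^ (2 ^ n) :=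
      pow_le_pow_right₀ hone.le Nat.lt_two_pow_self.le
    linarith

variable {τ : M →ₚ[ℂ] ℂ}

/-- `T_t` as an operator on `M` with the norm `‖·‖_2`. -/
def SymSemigroup.preT2 (S : SymSemigroup τ) (t : ℝ≥0) : τ.PreGNS →L[ℂ] τ.PreGNS :=
  LinearMap.mkContinuous (τ.toPreGNS.toLinearMap ∘ₗ S.T t ∘ₗ τ.ofPreGNS.toLinearMap) 1
    (fun a => by
      rw [one_mul]
      exact norm_map_le τ (S.T t) (S.contraction' t) (S.symmetric' t) (τ.ofPreGNS a))

/-- The extension of `T_t` to a contraction of `L_2(M)`. -/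
def SymSemigroup.T2 (S : SymSemigroup τ) (t : ℝ≥0) : L2 τ →L[ℂ] L2 τ :=
  (S.preT2 t).completion

lemma SymSemigroup.T2_emb (S : SymSemigroup τ) (t : ℝ≥0) (a : M) :
    S.T2 t (emb τ a) = emb τ (S.T t a) := by
  simp [T2, emb, preT2]

/-- The generator `L` on `L_2(M)`, with `T_t = e^{-tL}`: its domain consists of the `x ∈ L_2(M)`
for which `(x - T_t x) / t` converges in `L_2(M)` as `t → 0⁺`, and `L x` is the limit. -/
def SymSemigroup.generator (S : SymSemigroup τ) : L2 τ →ₗ.[ℂ] L2 τ where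
  domain :=
    { carrier := {x | ∃ y, Tendsto (fun t : ℝ≥0 => ((t : ℝ)⁻¹ : ℂ) • (x - S.T2 t x))
        (𝓝[>] 0) (𝓝 y)}
      zero_mem' := ⟨0, by simp⟩
      add_mem' := by
        rintro x x' ⟨y, hy⟩ ⟨y', hy'⟩
        refine ⟨y + y', (hy.add hy').congr fun t => ?_⟩
        rw [map_add, ← smul_add]; congr 1; abel
      smul_mem' := by
        rintro c x ⟨y, hy⟩
        refine ⟨c • y, (hy.const_smul c).congr fun t => ?_⟩
        rw [map_smul, smul_comm, smul_sub] }
  toFun :=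
    { toFun := fun x => x.2.choose
      map_add' := by
        intro x x'
        refine tendsto_nhds_unique (x + x').2.choose_spec
          ((x.2.choose_spec.add x'.2.choose_spec).congr fun t => ?_)
        rw [Submodule.coe_add, map_add, ← smul_add]; congr 1; abel
      map_smul' := by
        intro c x
        refine tendsto_nhds_unique (c • x).2.choose_spec
          ((x.2.choose_spec.const_smul c).congr fun t => ?_)
        rw [Submodule.coe_smul, map_smul, ← smul_sub, smul_comm] }

lemma SymSemigroup.mem_domain_iff (S : SymSemigroup τ) (x : L2 τ) :
    x ∈ S.generator.domain ↔ ∃ y, Tendsto (fun t : ℝ≥0 => ((t : ℝ)⁻¹ : ℂ) • (x - S.T2 t x))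
      (𝓝[>] 0) (𝓝 y) := Iff.rfl

lemma SymSemigroup.generator_tendsto (S : SymSemigroup τ) (x : S.generator.domain) :
    Tendsto (fun t : ℝ≥0 => ((t : ℝ)⁻¹ : ℂ) • ((x : L2 τ) - S.T2 t x)) (𝓝[>] 0)
      (𝓝 (S.generator x)) := x.2.choose_spec

/-! ### Strictly positive elements of `L_2(M)` and their powers -/

/-- `x ∈ L_2(M)`, a possibly unbounded operator affiliated with `M`, is strictly positive
(that is, positive with `0` not in its spectrum), and `b = x⁻¹`.
This says exactly that `b` is a positive element of `M` with `b x = 1`: the operator `b` then has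
dense range, so it is injective, and `x = b⁻¹ ≥ ‖b‖⁻¹`. -/
structure IsStrictlyPositiveWithInverse (τ : M →ₚ[ℂ] ℂ) (x : L2 τ) (b : M) : Prop where
  inv_nonneg : 0 ≤ b
  inv_mul : lmul τ b x = emb τ 1

/-- For `0 ≤ r ≤ 1` and a strictly positive `x ∈ L_2(M)` with inverse `b`, the power
`x ^ r = (x⁻¹) ^ (1 - r) x` in `L_2(M)`. -/
def powL2 (τ : M →ₚ[ℂ] ℂ) (x : L2 τ) (b : M) (r : ℝ) : L2 τ := lmul τ (b ^ (1 - r)) x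

/-- The bounded operator `min(x, n + 1) ^ r ∈ M`, where `x = b⁻¹`: functional calculus of `b` with
`s ↦ min(s⁻¹, n + 1) ^ r = max(s, 1 / (n + 1)) ^ (-r)`. -/
def truncPow (b : M) (r : ℝ) (n : ℕ) : M :=
  cfc (fun s : ℝ => (max s ((n : ℝ) + 1)⁻¹) ^ (-r)) b

/-- `τ(x ^ r ζ) = c`, for `x = b⁻¹` and `ζ ∈ L_2(M)`, where `x ^ r` may be unbounded: the numbers
`τ(min(x, n) ^ r ζ)` tend to `c`. (They do if `x ^ r ζ` is in `L_1(M)` with trace `c`,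
and `min(x, n) ^ r = x ^ r` for large `n` if `x` is bounded.) -/
def HasTracePow (τ : M →ₚ[ℂ] ℂ) (b : M) (r : ℝ) (ζ : L2 τ) (c : ℂ) : Prop :=
  Tendsto (fun n : ℕ => trL2 τ (lmul τ (truncPow b r n) ζ)) atTop (𝓝 c)

/-- The Dirichlet form value "`τ(x ^ r L y)`", for `x = b⁻¹` and `y ∈ L_2(M)`, exists and is `c`:
`lim_{t → 0⁺} τ(x ^ r (y - T_t y) / t) = c`. -/
def SymSemigroup.HasFormValue (S : SymSemigroup τ) (b : M) (r : ℝ) (y : L2 τ) (c : ℂ) : Prop :=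
  ∃ e : ℝ≥0 → ℂ,
    (∀ t : ℝ≥0, 0 < t → HasTracePow τ b r (((t : ℝ)⁻¹ : ℂ) • (y - S.T2 t y)) (e t)) ∧
    Tendsto e (𝓝[>] 0) (𝓝 c)

/-! ### Consistency of the definitions on bounded elements -/

/-- An invertible positive `a ∈ M` is strictly positive in `L_2(M)`. -/
lemma isStrictlyPositiveWithInverse_emb (τ : M →ₚ[ℂ] ℂ) (a : M) (ha : IsStrictlyPositive a) :
    IsStrictlyPositiveWithInverse τ (emb τ a) (Ring.inverse a) := by
  obtain ⟨h0, u, rfl⟩ := ha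
  refine ⟨?_, ?_⟩
  · rw [Ring.inverse_unit]
    exact (CFC.inv_nonneg_of_nonneg u h0)
  · simp [lmul, emb]

/-- On bounded elements, `powL2` is the power given by the functional calculus of `M`. -/
lemma powL2_emb (τ : M →ₚ[ℂ] ℂ) (a : M) (ha : IsStrictlyPositive a) (r : ℝ) :
    powL2 τ (emb τ a) (Ring.inverse a) r = emb τ (a ^ r) := by
  obtain ⟨h0, u, rfl⟩ := ha
  have h1 : ((Ring.inverse (u : M)) ^ (1 - r)) * (u : M) = (u : M) ^ r := by
    have hu : IsUnit (u : M) := u.isUnit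
    rw [Ring.inverse_unit, ← CFC.rpow_neg u _ h0]
    nth_rewrite 2 [← CFC.rpow_one (u : M) h0]
    rw [← CFC.rpow_add hu]
    congr 1; ring
  rw [powL2, lmul_emb, h1]

/-- On bounded elements, the truncated powers are eventually the power given by the functional
calculus of `M`. -/
lemma truncPow_eventually_eq (a : M) (ha : IsStrictlyPositive a) (r : ℝ) :
    ∀ᶠ n : ℕ in atTop, truncPow (Ring.inverse a) r n = a ^ r := by
  obtain ⟨h0, u, rfl⟩ := ha
  rw [Ring.inverse_unit]
  have hb0 : (0 : M) ≤ ((u⁻¹ : Mˣ) : M) := CFC.inv_nonneg_of_nonneg u h0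
  have hpos : ∀ s ∈ spectrum ℝ ((u⁻¹ : Mˣ) : M), 0 < s := fun s hs =>
    lt_of_le_of_ne (spectrum_nonneg_of_nonneg hb0 hs)
      (fun h => spectrum.zero_notMem ℝ (u⁻¹).isUnit (h ▸ hs))
  obtain ⟨m, hm, hms⟩ : ∃ m : ℝ, 0 < m ∧ ∀ s ∈ spectrum ℝ ((u⁻¹ : Mˣ) : M), m ≤ s := by
    rcases (spectrum ℝ ((u⁻¹ : Mˣ) : M)).eq_empty_or_nonempty with he | hne
    · exact ⟨1, one_pos, by simp [he]⟩
    · obtain ⟨m, hm, hmin⟩ := (spectrum.isCompact (𝕜 := ℝ) ((u⁻¹ : Mˣ) : M)).exists_isMinOn hne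
        continuousOn_id
      exact ⟨m, hpos m hm, fun s hs => hmin hs⟩
  filter_upwards [tendsto_one_div_add_atTop_nhds_zero_nat.eventually (gt_mem_nhds hm)] with n hn
  have h1 : ((u⁻¹ : Mˣ) : M) ^ (-r) = (u : M) ^ r := by
    simpa using CFC.rpow_neg (u⁻¹) r hb0
  rw [← h1, CFC.rpow_eq_cfc_real hb0, truncPow]
  refine cfc_congr fun s hs => ?_
  rw [max_eq_left]
  rw [one_div] at hn
  exact hn.le.trans (hms s hs)

end NCSemigroup

end

/-!
Write `α = 2 / q` and `β = 2 / q'`, so that `α + β = 2`; put `γ = 1 - α ∈ [0, 1)`, so that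
`β = 1 + γ` and `q² / (4 (q - 1)) = 1 / (αβ) = 1 / (1 - γ²) ≥ 1`.

*Comparison.* All operators to which `T_t` and the trace are applied are functions of the single
operator `b = x⁻¹`. Positivity and symmetry of `T_t` give, for the form
`⟨f(b), (1 - T_t) g(b)⟩`, the classical representation
`∫ f g dκ + ∬ (f(s) - f(r)) (g(s) - g(r)) dw(s, r)` with positive `κ` and `w`. No measure on the
product is constructed: replacing `f` and `g` by Bernstein approximations gives finite sums of this
shape that converge to the form (`SymSemigroup.exists_discretization`), so that pointwise
inequalities pass to the forms (`SymSemigroup.sum_form_nonneg`). The pointwise inequalities are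
`αβ (u - v)² ≤ (u ^ α - v ^ α) (u ^ β - v ^ β) ≤ (u - v)²` for `u, v > 0`. Both follow from
`(u - v)² - (u ^ α - v ^ α) (u ^ β - v ^ β) = powGap γ u v ^ 2`, where
`|powGap γ u v| ≤ γ |u - v|` amounts to `sinh (γ s) ≤ γ sinh s`.

*Existence of the limits.* Let `x_n = min(x, n + 1)` and `y = x ^ α`. The numbers
`g_t(n) = t⁻¹ ⟨x_n ^ β, (1 - T_t) y⟩` increase with `n` and are bounded by the energy
`t⁻¹ ⟨x, (1 - T_t) x⟩`, so they converge as `n → ∞`. For fixed `n` they converge as `t → 0`, because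
`x_n ^ β` and `y` have finite energy (`SymSemigroup.exists_tendsto_form`). The two limits may be
interchanged because truncation decreases `powGap²` (`powGap_min_sq_le`): it follows that
`g_t(k) - g_t(n) ≤ t⁻¹ (⟨x, (1 - T_t) x⟩ - ⟨x_n, (1 - T_t) x_n⟩)` for `k ≥ n`
(`SymSemigroup.form_sub_form_le`), and the energy of `x_n` tends to that of `x`
(`exists_limit_of_deficit`).

That bounded powers approximate `x ^ r` in `L_2(M)` for `0 ≤ r ≤ 1` comes from the injectivity of
`b` on `L_2(M)`, a consequence of `b x = 1` and of traciality
(`IsStrictlyPositiveWithInverse.tendsto_emb_truncPow`).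
-/

noncomputable section
namespace NCSemigroup

universe u

variable {M : Type u} [CStarAlgebra M] [PartialOrder M] [StarOrderedRing M] {τ : M →ₚ[ℂ] ℂ}

/-! ### Inequalities between powers of two positive numbers -/

/-- The quantity `g = (uv)^((1-γ)/2) (v^γ - u^γ)`, whose square is the defect
`(u - v)² - (u^(1-γ) - v^(1-γ)) (u^(1+γ) - v^(1+γ))`. -/
def powGap (γ u v : ℝ) : ℝ := (u * v) ^ ((1 - γ) / 2) * (v ^ γ - u ^ γ)

lemma powGap_swap (γ u v : ℝ) : powGap γ v u = -powGap γ u v := by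
  unfold powGap; rw [mul_comm v u]; ring

lemma powGap_self (γ u : ℝ) : powGap γ u u = 0 := by simp [powGap]

lemma rpow_sub_mul_rpow_sub (γ : ℝ) {u v : ℝ} (hu : 0 < u) (hv : 0 < v) :
    (u ^ (1 - γ) - v ^ (1 - γ)) * (u ^ (1 + γ) - v ^ (1 + γ))
      = (u - v) ^ 2 - powGap γ u v ^ 2 := by
  have h1 : ((u * v) ^ ((1 - γ) / 2)) ^ 2 = u ^ (1 - γ) * v ^ (1 - γ) := by
    rw [← Real.mul_rpow hu.le hv.le, ← Real.rpow_natCast, ← Real.rpow_mul (by positivity)]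
    congr 1; push_cast; ring
  have h2 : ∀ w : ℝ, 0 < w → w ^ (1 + γ) = w ^ (1 - γ) * (w ^ γ) ^ 2 := fun w hw => by
    rw [← Real.rpow_natCast, ← Real.rpow_mul hw.le, ← Real.rpow_add hw]
    congr 1; push_cast; ring
  have h3 : ∀ w : ℝ, 0 < w → w = w ^ (1 - γ) * w ^ γ := fun w hw => by
    rw [← Real.rpow_add hw]; simp
  unfold powGap
  rw [mul_pow, h1, h2 u hu, h2 v hv]
  have e : (u - v) ^ 2 = (u ^ (1 - γ) * u ^ γ - v ^ (1 - γ) * v ^ γ) ^ 2 := by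
    rw [← h3 u hu, ← h3 v hv]
  rw [e]; ring

lemma powGap_nonneg {γ u v : ℝ} (h0 : 0 ≤ γ) (hu : 0 < u) (huv : u ≤ v) : 0 ≤ powGap γ u v := by
  have := Real.rpow_le_rpow hu.le huv h0
  have hv : 0 < v := hu.trans_le huv
  exact mul_nonneg (by positivity) (by linarith)

lemma powGap_mono {γ u w v : ℝ} (h0 : 0 ≤ γ) (h1 : γ ≤ 1) (hu : 0 < u) (huw : u ≤ w)
    (hwv : w ≤ v) : powGap γ u w ≤ powGap γ u v := by
  have hw : 0 < w := hu.trans_le huw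
  have a := Real.rpow_le_rpow hu.le huw h0
  have c := Real.rpow_le_rpow hw.le hwv h0
  unfold powGap
  have : (u * w) ^ ((1 - γ) / 2) ≤ (u * v) ^ ((1 - γ) / 2) :=
    Real.rpow_le_rpow (by positivity) (by gcongr) (by linarith)
  exact mul_le_mul this (by linarith) (by linarith) (Real.rpow_nonneg (by nlinarith) _)

lemma sinh_mul_le {γ : ℝ} (h0 : 0 ≤ γ) (h1 : γ ≤ 1) {s : ℝ} (hs : 0 ≤ s) :
    Real.sinh (γ * s) ≤ γ * Real.sinh s := by
  have hd : ∀ y : ℝ, HasDerivAt (fun y => γ * Real.sinh y - Real.sinh (γ * y))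
      (γ * Real.cosh y - Real.cosh (γ * y) * (γ * 1)) y := fun y =>
    ((Real.hasDerivAt_sinh y).const_mul γ).sub
      ((Real.hasDerivAt_sinh (γ * y)).comp y ((hasDerivAt_id y).const_mul γ))
  have hm : MonotoneOn (fun y => γ * Real.sinh y - Real.sinh (γ * y)) (Set.Ici 0) := by
    refine monotoneOn_of_deriv_nonneg (convex_Ici 0)
      (fun y _ => (hd y).continuousAt.continuousWithinAt)
      (fun y _ => (hd y).differentiableAt.differentiableWithinAt) fun y hy => ?_
    rw [interior_Ici] at hy
    rw [(hd y).deriv]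
    have hy : 0 < y := hy
    have : Real.cosh (γ * y) ≤ Real.cosh y := by
      rw [Real.cosh_le_cosh, abs_of_nonneg (by positivity), abs_of_pos hy]
      nlinarith
    nlinarith
  have := hm (Set.self_mem_Ici) (Set.mem_Ici.2 hs) hs
  simp at this
  linarith

lemma powGap_le {γ u v : ℝ} (h0 : 0 ≤ γ) (h1 : γ ≤ 1) (hu : 0 < u) (huv : u ≤ v) :
    powGap γ u v ≤ γ * (v - u) := by
  obtain ⟨a, rfl⟩ : ∃ a, Real.exp (2 * a) = u :=
    ⟨Real.log u / 2, by rw [mul_div_cancel₀ _ two_ne_zero, Real.exp_log hu]⟩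
  obtain ⟨c, rfl⟩ : ∃ c, Real.exp (2 * c) = v :=
    ⟨Real.log v / 2, by rw [mul_div_cancel₀ _ two_ne_zero, Real.exp_log (hu.trans_le huv)]⟩
  have hac : a ≤ c := by simpa using huv
  have key := sinh_mul_le h0 h1 (sub_nonneg.2 hac)
  have he : ∀ y d : ℝ, 2 * Real.exp y * Real.sinh d = Real.exp (y + d) - Real.exp (y - d) := by
    intro y d
    rw [Real.sinh_eq, sub_eq_add_neg y, Real.exp_add, Real.exp_add]; ring
  have e1 : powGap γ (Real.exp (2 * a)) (Real.exp (2 * c))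
      = 2 * Real.exp (a + c) * Real.sinh (γ * (c - a)) := by
    unfold powGap
    rw [he, ← Real.exp_add, ← Real.exp_mul, ← Real.exp_mul, ← Real.exp_mul, mul_sub,
      ← Real.exp_add, ← Real.exp_add]
    congr 2 <;> ring
  have e2 : Real.exp (2 * c) - Real.exp (2 * a) = 2 * Real.exp (a + c) * Real.sinh (c - a) := by
    rw [he]
    congr 2 <;> ring
  rw [e1, e2]
  have := Real.exp_pos (a + c)
  nlinarith

lemma powGap_sq_le {γ u v : ℝ} (h0 : 0 ≤ γ) (h1 : γ ≤ 1) (hu : 0 < u) (hv : 0 < v) :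
    powGap γ u v ^ 2 ≤ γ ^ 2 * (u - v) ^ 2 := by
  rcases le_total u v with h | h
  · have a := powGap_nonneg h0 hu h
    have c := powGap_le h0 h1 hu h
    nlinarith
  · have a := powGap_nonneg h0 hv h
    have c := powGap_le h0 h1 hv h
    have e := powGap_swap γ v u
    rw [e, neg_sq]
    nlinarith

/-- Truncation decreases the defect between `(u - v)²` and the product of power differences. -/
lemma powGap_min_sq_le {γ u v N : ℝ} (h0 : 0 ≤ γ) (h1 : γ ≤ 1) (hu : 0 < u) (hv : 0 < v) :
    powGap γ (min u N) (min v N) ^ 2 ≤ powGap γ u v ^ 2 := by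
  wlog huv : u ≤ v generalizing u v
  · have := this hv hu (le_of_not_ge huv)
    rwa [powGap_swap γ (min u N), powGap_swap γ u, neg_sq, neg_sq] at this
  rcases le_total N u with h | h
  · rw [min_eq_right h, min_eq_right (h.trans huv), powGap_self]
    simpa using sq_nonneg _
  · rw [min_eq_left h]
    have a : u ≤ min v N := le_min huv h
    exact pow_le_pow_left₀ (powGap_nonneg h0 hu a)
      (powGap_mono h0 h1 hu a (min_le_left _ _)) 2

/-- Truncating the second factor at a lower level decreases the product of power differences. -/
lemma rpow_sub_mul_rpow_min_sub_mono {r s u v N K : ℝ} (hr : 0 ≤ r) (hs : 0 ≤ s) (hu : 0 < u)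
    (hv : 0 < v) (hN : 0 < N) (hNK : N ≤ K) :
    (u ^ r - v ^ r) * ((min u N) ^ s - (min v N) ^ s)
      ≤ (u ^ r - v ^ r) * ((min u K) ^ s - (min v K) ^ s) := by
  wlog huv : u ≤ v generalizing u v
  · have := this hv hu (le_of_not_ge huv)
    linarith
  have a : u ^ r ≤ v ^ r := Real.rpow_le_rpow hu.le huv hr
  suffices (min v N) ^ s - (min u N) ^ s ≤ (min v K) ^ s - (min u K) ^ s by nlinarith
  rcases le_total N u with h | h
  · rw [min_eq_right h, min_eq_right (h.trans huv)]
    have : (min u K) ^ s ≤ (min v K) ^ s :=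
      Real.rpow_le_rpow (by have := hN.trans_le hNK; positivity) (min_le_min_right _ huv) hs
    linarith
  · rw [min_eq_left h, min_eq_left (h.trans hNK)]
    have : (min v N) ^ s ≤ (min v K) ^ s :=
      Real.rpow_le_rpow (by positivity) (min_le_min_left _ hNK) hs
    linarith

/-- Truncating the first factor as well decreases the product of power differences. -/
lemma rpow_min_sub_mul_rpow_min_sub_le {r s u v N : ℝ} (hr : 0 ≤ r) (hs : 0 ≤ s) (hu : 0 < u)
    (hv : 0 < v) (hN : 0 < N) :
    ((min u N) ^ r - (min v N) ^ r) * ((min u N) ^ s - (min v N) ^ s)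
      ≤ (u ^ r - v ^ r) * ((min u N) ^ s - (min v N) ^ s) := by
  have h := rpow_sub_mul_rpow_min_sub_mono (r := s) (s := r) (u := min u N) (v := min v N)
    hs hr (lt_min hu hN) (lt_min hv hN) hN le_rfl
  wlog huv : u ≤ v generalizing u v
  · have := this hv hu (rpow_sub_mul_rpow_min_sub_mono hs hr (lt_min hv hN) (lt_min hu hN) hN
      le_rfl) (le_of_not_ge huv)
    linarith
  have a : (min u N) ^ s ≤ (min v N) ^ s :=
    Real.rpow_le_rpow (lt_min hu hN).le (min_le_min_right _ huv) hs
  suffices (min v N) ^ r - (min u N) ^ r ≤ v ^ r - u ^ r by nlinarith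
  rcases le_total N u with h | h
  · rw [min_eq_right h, min_eq_right (h.trans huv)]
    have := Real.rpow_le_rpow hu.le huv hr
    linarith
  · rw [min_eq_left h]
    have : (min v N) ^ r ≤ v ^ r := Real.rpow_le_rpow (lt_min hv hN).le (min_le_left _ _) hr
    linarith

lemma sq_rpow_sub_rpow_le {r u v K : ℝ} (hr0 : 0 ≤ r) (hr2 : r ≤ 2) (hu : 0 < u) (hv : 0 < v)
    (hKu : u ^ (r - 1) ≤ K) (hKv : v ^ (r - 1) ≤ K) :
    (u ^ r - v ^ r) ^ 2 ≤ (2 * K) ^ 2 * (u - v) ^ 2 := by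
  wlog huv : v ≤ u generalizing u v
  · have := this hv hu hKv hKu (le_of_not_ge huv)
    linarith
  have h1 : v ^ r ≤ u ^ r := Real.rpow_le_rpow hv.le huv hr0
  -- `(v / u) ^ r ≥ (v / u) ^ 2` because `v / u ≤ 1`
  have h2 : (v / u) ^ 2 ≤ (v / u) ^ r := by
    rw [← Real.rpow_natCast]
    exact Real.rpow_le_rpow_of_exponent_ge (by positivity) ((div_le_one hu).2 huv)
      (by exact_mod_cast hr2)
  have h3 : v ^ r = (v / u) ^ r * u ^ r := by
    rw [← Real.mul_rpow (by positivity) hu.le, div_mul_cancel₀ _ hu.ne']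
  have h4 : u ^ r = u ^ (r - 1) * u := by
    rw [Real.rpow_sub hu, Real.rpow_one, div_mul_cancel₀ _ hu.ne']
  have hp : 0 < u ^ (r - 1) := Real.rpow_pos_of_pos hu _
  have h5 : u ^ r - v ^ r ≤ 2 * K * (u - v) := by
    calc u ^ r - v ^ r ≤ u ^ r - (v / u) ^ 2 * u ^ r := by
          rw [h3]; gcongr
      _ = u ^ (r - 1) * ((1 + v / u) * (u - v)) := by rw [h4]; field_simp; ring
      _ ≤ K * (2 * (u - v)) := by
          have : v / u ≤ 1 := (div_le_one hu).2 huv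
          have : 0 ≤ u - v := by linarith
          gcongr
          · exact hp.le.trans hKu
          · linarith
      _ = _ := by ring
  rw [← mul_pow]
  exact pow_le_pow_left₀ (by linarith) h5 2

/-! ### The quadratic forms of the semigroup on `L_2(M)` -/

lemma denseRange_emb (τ : M →ₚ[ℂ] ℂ) : DenseRange (emb τ) :=
  UniformSpace.Completion.denseRange_coe.comp τ.toPreGNS.surjective.denseRange
    (UniformSpace.Completion.continuous_coe _)

lemma emb_sub (τ : M →ₚ[ℂ] ℂ) (a c : M) : emb τ (a - c) = emb τ a - emb τ c := by
  simp [emb, UniformSpace.Completion.coe_sub]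

lemma SymSemigroup.inner_T2 (S : SymSemigroup τ) (t : ℝ≥0) (ξ η : L2 τ) :
    ⟪S.T2 t ξ, η⟫_ℂ = ⟪ξ, S.T2 t η⟫_ℂ := by
  refine (denseRange_emb τ).induction_on₂ (isClosed_eq (by fun_prop) (by fun_prop))
    (fun a c => ?_) ξ η
  rw [S.T2_emb, S.T2_emb, inner_emb, inner_emb, S.symmetric']

lemma SymSemigroup.T2_add (S : SymSemigroup τ) (s t : ℝ≥0) (ξ : L2 τ) :
    S.T2 (s + t) ξ = S.T2 s (S.T2 t ξ) := by
  refine (denseRange_emb τ).induction_on ξ (isClosed_eq (by fun_prop) (by fun_prop))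
    (fun a => ?_)
  rw [S.T2_emb, S.T2_emb, S.T2_emb, S.add']; rfl

lemma SymSemigroup.T2_zero (S : SymSemigroup τ) (ξ : L2 τ) : S.T2 0 ξ = ξ := by
  refine (denseRange_emb τ).induction_on ξ (isClosed_eq (by fun_prop) (by fun_prop))
    (fun a => ?_)
  rw [S.T2_emb, S.zero']; rfl

lemma norm_emb (τ : M →ₚ[ℂ] ℂ) (a : M) : ‖emb τ a‖ = ‖τ.toPreGNS a‖ :=
  UniformSpace.Completion.norm_coe _

lemma SymSemigroup.norm_T2_le (S : SymSemigroup τ) (t : ℝ≥0) (ξ : L2 τ) :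
    ‖S.T2 t ξ‖ ≤ ‖ξ‖ := by
  refine (denseRange_emb τ).induction_on ξ (isClosed_le (by fun_prop) (by fun_prop))
    (fun a => ?_)
  rw [S.T2_emb, norm_emb, norm_emb]
  exact norm_map_le τ (S.T t) (S.contraction' t) (S.symmetric' t) a

/-- The real part of `⟨ξ, η - T_t η⟩`. -/
def SymSemigroup.form (S : SymSemigroup τ) (t : ℝ≥0) (ξ η : L2 τ) : ℝ :=
  (⟪ξ, η - S.T2 t η⟫_ℂ).re

lemma SymSemigroup.continuous_form_right (S : SymSemigroup τ) (t : ℝ≥0) (ξ : L2 τ) :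
    Continuous fun η => S.form t ξ η := by
  unfold form; fun_prop

lemma SymSemigroup.continuous_form_diag (S : SymSemigroup τ) (t : ℝ≥0) :
    Continuous fun η => S.form t η η := by
  unfold form; fun_prop

lemma SymSemigroup.form_comm (S : SymSemigroup τ) (t : ℝ≥0) (ξ η : L2 τ) :
    S.form t ξ η = S.form t η ξ := by
  unfold form
  rw [inner_sub_right, inner_sub_right, Complex.sub_re, Complex.sub_re, ← S.inner_T2,
    ← inner_conj_symm, Complex.conj_re, ← inner_conj_symm (S.T2 t ξ), Complex.conj_re]

lemma SymSemigroup.form_self_im (S : SymSemigroup τ) (t : ℝ≥0) (ξ : L2 τ) :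
    (⟪ξ, ξ - S.T2 t ξ⟫_ℂ).im = 0 := by
  have h : (starRingEnd ℂ) ⟪ξ, ξ - S.T2 t ξ⟫_ℂ = ⟪ξ, ξ - S.T2 t ξ⟫_ℂ := by
    rw [inner_conj_symm, inner_sub_right, inner_sub_left, S.inner_T2]
  exact Complex.conj_eq_iff_im.1 h

lemma SymSemigroup.form_add_add (S : SymSemigroup τ) (t : ℝ≥0) (ξ η : L2 τ) :
    S.form t (ξ + η) (ξ + η) = S.form t ξ ξ + 2 * S.form t ξ η + S.form t η η := by
  have h := S.form_comm t ξ η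
  unfold form at *
  simp only [map_add, inner_add_left, inner_sub_right, inner_add_right, Complex.add_re,
    Complex.sub_re] at *
  linarith

lemma SymSemigroup.form_sub_sub (S : SymSemigroup τ) (t : ℝ≥0) (ξ η : L2 τ) :
    S.form t (ξ - η) (ξ - η) = S.form t ξ ξ - 2 * S.form t ξ η + S.form t η η := by
  have h := S.form_comm t ξ η
  unfold form at *
  simp only [map_sub, inner_sub_left, inner_sub_right, Complex.sub_re] at *
  linarith

/-- `⟨ξ, T_t ξ⟩ = ‖T_{t/2} ξ‖²`, since `T_t = (T_{t/2})* T_{t/2}`. -/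
lemma SymSemigroup.re_inner_T2 (S : SymSemigroup τ) (t : ℝ≥0) (ξ : L2 τ) :
    (⟪ξ, S.T2 t ξ⟫_ℂ).re = ‖S.T2 (t / 2) ξ‖ ^ 2 := by
  nth_rewrite 1 [← add_halves t]
  rw [S.T2_add, ← S.inner_T2, inner_self_eq_norm_sq_to_K]
  norm_cast

lemma SymSemigroup.form_self_eq (S : SymSemigroup τ) (t : ℝ≥0) (ξ : L2 τ) :
    S.form t ξ ξ = ‖ξ‖ ^ 2 - ‖S.T2 (t / 2) ξ‖ ^ 2 := by
  rw [form, inner_sub_right, Complex.sub_re, S.re_inner_T2, inner_self_eq_norm_sq_to_K]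
  norm_cast

lemma SymSemigroup.form_self_nonneg (S : SymSemigroup τ) (t : ℝ≥0) (ξ : L2 τ) :
    0 ≤ S.form t ξ ξ := by
  rw [S.form_self_eq, sub_nonneg]
  exact pow_le_pow_left₀ (norm_nonneg _) (S.norm_T2_le _ _) 2

lemma SymSemigroup.form_self_mono (S : SymSemigroup τ) {s t : ℝ≥0} (h : s ≤ t) (ξ : L2 τ) :
    S.form s ξ ξ ≤ S.form t ξ ξ := by
  rw [S.form_self_eq, S.form_self_eq]
  have h1 : t / 2 = (t / 2 - s / 2) + s / 2 :=
    (tsub_add_cancel_of_le (by gcongr)).symm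
  rw [h1, S.T2_add]
  gcongr
  exact S.norm_T2_le _ _

/-- `1 - T_{ks} ≤ k (1 - T_s)`: the increments `⟨ξ, T_{ks}(1 - T_s) ξ⟩` decrease with `k`, because
`T_{ks} (1 - T_s)² ≥ 0`. -/
lemma SymSemigroup.form_nsmul_le (S : SymSemigroup τ) (s : ℝ≥0) (ξ : L2 τ) (k : ℕ) :
    S.form (k * s) ξ ξ ≤ k * S.form s ξ ξ := by
  have hdec : ∀ k : ℕ, (⟪ξ, S.T2 (k * s) (ξ - S.T2 s ξ)⟫_ℂ).re ≤ S.form s ξ ξ := by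
    intro k
    induction k with
    | zero => simp [form, S.T2_zero]
    | succ k ih =>
      refine le_trans ?_ ih
      have h0 : 0 ≤ (⟪ξ - S.T2 s ξ, S.T2 (k * s) (ξ - S.T2 s ξ)⟫_ℂ).re := by
        rw [S.re_inner_T2]; positivity
      have h1 : S.T2 (((k + 1 : ℕ) : ℝ≥0) * s) (ξ - S.T2 s ξ)
          = S.T2 s (S.T2 (k * s) (ξ - S.T2 s ξ)) := by
        rw [← S.T2_add]; congr 2; push_cast; ring
      rw [h1, ← S.inner_T2]
      rw [inner_sub_left, Complex.sub_re] at h0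
      linarith
  induction k with
  | zero => simp [form, S.T2_zero]
  | succ k ih =>
    have h1 : S.T2 (((k + 1 : ℕ) : ℝ≥0) * s) ξ = S.T2 (k * s) (S.T2 s ξ) := by
      rw [← S.T2_add]; congr 2; push_cast; ring
    have h2 : S.form (((k + 1 : ℕ) : ℝ≥0) * s) ξ ξ
        = S.form (k * s) ξ ξ + (⟪ξ, S.T2 (k * s) (ξ - S.T2 s ξ)⟫_ℂ).re := by
      unfold form
      rw [h1, map_sub]
      simp only [inner_sub_right, Complex.sub_re]
      ring
    have := hdec k
    rw [h2]; push_cast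
    linarith

/-- A substitute for the monotonicity of `t ↦ t⁻¹ ⟨ξ, ξ - T_t ξ⟩`, which would need the spectral
theorem: it holds up to a factor tending to `1` as `s → 0`. -/
lemma SymSemigroup.mul_form_self_le (S : SymSemigroup τ) {s : ℝ≥0} (hs : 0 < s) (t : ℝ≥0)
    (ξ : L2 τ) : (s : ℝ) * S.form t ξ ξ ≤ (t + s) * S.form s ξ ξ := by
  set k := ⌊t / s⌋₊ + 1
  have h1 : t ≤ k * s := by
    have := (Nat.lt_floor_add_one (t / s)).le
    rw [div_le_iff₀ hs] at this
    exact_mod_cast this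
  have h2 : (k : ℝ) * s ≤ t + s := by
    have : (⌊t / s⌋₊ : ℝ≥0) ≤ t / s := Nat.floor_le (by positivity)
    rw [le_div_iff₀ hs] at this
    have : (⌊t / s⌋₊ : ℝ) * s ≤ t := by exact_mod_cast this
    simp only [k]; push_cast; linarith
  have h3 := (S.form_self_mono h1 ξ).trans (S.form_nsmul_le s ξ k)
  have h4 := S.form_self_nonneg s ξ
  have h5 : (0 : ℝ) ≤ s := s.2
  nlinarith

lemma tendsto_coe_nhdsGT_zero : Tendsto (fun s : ℝ≥0 => (s : ℝ)) (𝓝[>] 0) (𝓝 0) :=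
  (NNReal.continuous_coe.tendsto' 0 0 rfl).mono_left nhdsWithin_le_nhds

/-- If `t⁻¹ ⟨ξ, ξ - T_t ξ⟩` converges as `t → 0`, then its limit is its supremum. -/
lemma SymSemigroup.form_self_le_of_tendsto (S : SymSemigroup τ) {ξ : L2 τ} {l : ℝ}
    (h : Tendsto (fun s : ℝ≥0 => (s : ℝ)⁻¹ * S.form s ξ ξ) (𝓝[>] 0) (𝓝 l)) (t : ℝ≥0) :
    S.form t ξ ξ ≤ t * l := by
  have h1 : Tendsto (fun s : ℝ≥0 => ((t : ℝ) + s) * ((s : ℝ)⁻¹ * S.form s ξ ξ)) (𝓝[>] 0)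
      (𝓝 ((t + 0) * l)) := (tendsto_coe_nhdsGT_zero.const_add _).mul h
  rw [add_zero] at h1
  refine ge_of_tendsto h1 (eventually_mem_nhdsWithin.mono fun s hs => ?_)
  have hs : 0 < s := hs
  have h2 := S.mul_form_self_le hs t ξ
  have h3 : (0 : ℝ) < s := hs
  rw [mul_left_comm, ← div_eq_inv_mul, le_div_iff₀ h3]
  linarith

lemma SymSemigroup.exists_tendsto_form_self (S : SymSemigroup τ) {ξ : L2 τ} {K : ℝ}
    (h : ∀ t : ℝ≥0, S.form t ξ ξ ≤ t * K) :
    ∃ l, Tendsto (fun s : ℝ≥0 => (s : ℝ)⁻¹ * S.form s ξ ξ) (𝓝[>] 0) (𝓝 l) := by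
  have hb : ∀ t : Set.Ioi (0 : ℝ≥0), ((t : ℝ≥0) : ℝ)⁻¹ * S.form t ξ ξ ≤ K := fun t => by
    have ht : (0 : ℝ) < (t : ℝ≥0) := t.2
    rw [inv_mul_le_iff₀ ht]
    exact h t
  have hbdd : BddAbove (Set.range fun t : Set.Ioi (0 : ℝ≥0) =>
      ((t : ℝ≥0) : ℝ)⁻¹ * S.form t ξ ξ) := ⟨K, by rintro _ ⟨t, rfl⟩; exact hb t⟩
  have : Nonempty (Set.Ioi (0 : ℝ≥0)) := ⟨⟨1, Set.mem_Ioi.2 one_pos⟩⟩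
  refine ⟨⨆ t : Set.Ioi (0 : ℝ≥0), ((t : ℝ≥0) : ℝ)⁻¹ * S.form t ξ ξ, ?_⟩
  rw [tendsto_order]
  constructor
  · intro c hc
    obtain ⟨⟨t, ht⟩, hct⟩ := exists_lt_of_lt_ciSup hc
    have ht' : (0 : ℝ) < t := ht
    have h1 : Tendsto (fun s : ℝ≥0 => ((t : ℝ) + s)⁻¹ * S.form t ξ ξ) (𝓝[>] 0)
        (𝓝 ((t + 0 : ℝ)⁻¹ * S.form t ξ ξ)) :=
      ((tendsto_coe_nhdsGT_zero.const_add _).inv₀ (by simpa using ht'.ne')).mul_const _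
    rw [add_zero] at h1
    filter_upwards [h1.eventually (lt_mem_nhds hct), self_mem_nhdsWithin] with s hs hs0
    refine hs.trans_le ?_
    have h3 : (0 : ℝ) < s := hs0
    rw [inv_mul_le_iff₀ (by positivity), mul_left_comm, ← div_eq_inv_mul, le_div_iff₀ h3,
      mul_comm _ (s : ℝ)]
    exact S.mul_form_self_le hs0 t ξ
  · intro c hc
    filter_upwards [self_mem_nhdsWithin] with s hs
    exact (le_ciSup hbdd ⟨s, hs⟩).trans_lt hc

/-- Polarization: the form converges off the diagonal at vectors of finite energy. -/
lemma SymSemigroup.exists_tendsto_form (S : SymSemigroup τ) {ξ η : L2 τ} {K K' : ℝ}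
    (h : ∀ t : ℝ≥0, S.form t ξ ξ ≤ t * K) (h' : ∀ t : ℝ≥0, S.form t η η ≤ t * K') :
    ∃ l, Tendsto (fun s : ℝ≥0 => (s : ℝ)⁻¹ * S.form s ξ η) (𝓝[>] 0) (𝓝 l) := by
  obtain ⟨l, hl⟩ := S.exists_tendsto_form_self (ξ := ξ + η) (K := 2 * K + 2 * K') fun t => by
    have := S.form_self_nonneg t (ξ - η)
    rw [S.form_sub_sub] at this
    rw [S.form_add_add]
    linarith [h t, h' t]
  obtain ⟨l', hl'⟩ := S.exists_tendsto_form_self (ξ := ξ - η) (K := 2 * K + 2 * K') fun t => by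
    have := S.form_self_nonneg t (ξ + η)
    rw [S.form_add_add] at this
    rw [S.form_sub_sub]
    linarith [h t, h' t]
  refine ⟨4⁻¹ * (l - l'), ((hl.sub hl').const_mul 4⁻¹).congr fun t => ?_⟩
  rw [S.form_add_add, S.form_sub_sub]
  ring

/-! ### Discretization of the forms on the functional calculus of `b` -/

lemma spectrum_subset_Icc {b : M} (hb : 0 ≤ b) : spectrum ℝ b ⊆ Set.Icc 0 (‖b‖ + 1) := by
  intro s hs
  have : Nontrivial M := by
    by_contra h
    rw [not_nontrivial_iff_subsingleton] at h
    rw [spectrum.of_subsingleton] at hs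
    exact hs
  have := spectrum.norm_le_norm_of_mem hs
  exact ⟨spectrum_nonneg_of_nonneg hb hs, by linarith [Real.le_norm_self s]⟩

lemma re_trace_mul_nonneg (hτ : ∀ a c : M, τ (a * c) = τ (c * a)) {a c : M} (ha : 0 ≤ a)
    (hc : 0 ≤ c) : 0 ≤ (τ (a * c)).re := by
  obtain ⟨d, rfl⟩ := CStarAlgebra.nonneg_iff_eq_star_mul_self.1 hc
  rw [← mul_assoc, hτ, ← mul_assoc]
  exact (Complex.nonneg_iff.1 (map_nonneg τ (star_right_conjugate_nonneg ha d))).1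

/-- The Bernstein weight of index `k` and degree `n` for `[0, R]`, extended to the real line by
constants outside of `[0, R]`. -/
def bernsteinWeight (R : ℝ) (n k : ℕ) (s : ℝ) : ℝ :=
  bernstein n k (Set.projIcc 0 1 zero_le_one (s / R))

/-- The nodes `R k / n` of Bernstein approximation on `[0, R]`. -/
def bernsteinNode (R : ℝ) (n : ℕ) (k : Fin (n + 1)) : ℝ := R * (bernstein.z k : unitInterval)

lemma bernsteinNode_mem {R : ℝ} (hR : 0 < R) (n : ℕ) (k : Fin (n + 1)) :
    bernsteinNode R n k ∈ Set.Icc 0 R := by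
  have h := (bernstein.z k).2
  unfold bernsteinNode
  exact ⟨mul_nonneg hR.le h.1, mul_le_of_le_one_right hR.le h.2⟩

lemma continuous_bernsteinWeight (R : ℝ) (n k : ℕ) : Continuous (bernsteinWeight R n k) := by
  unfold bernsteinWeight
  exact (map_continuous _).comp (continuous_projIcc.comp (continuous_id.div_const R))

lemma cfc_bernsteinWeight_nonneg (b : M) (R : ℝ) (n k : ℕ) :
    0 ≤ cfc (bernsteinWeight R n k) b := cfc_nonneg fun _ _ => bernstein_nonneg

lemma tendsto_sum_cfc_bernsteinWeight {b : M} (hb : 0 ≤ b) {f : ℝ → ℝ} (hf : Continuous f) :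
    Tendsto (fun n => ∑ k : Fin (n + 1), f (bernsteinNode (‖b‖ + 1) n k) •
      cfc (bernsteinWeight (‖b‖ + 1) n k) b) atTop (𝓝 (cfc f b)) := by
  set R := ‖b‖ + 1
  have hR0 : 0 < R := by positivity
  let F : C(unitInterval, ℝ) := ⟨fun p => f (R * p), by fun_prop⟩
  have hsum : ∀ n, ∑ k : Fin (n + 1), f (bernsteinNode R n k) • cfc (bernsteinWeight R n k) b
      = cfc (fun s => bernsteinApproximation n F (Set.projIcc 0 1 zero_le_one (s / R))) b := by
    intro n
    have hc := continuous_bernsteinWeight R n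
    have : (fun s => bernsteinApproximation n F (Set.projIcc 0 1 zero_le_one (s / R)))
        = ∑ k : Fin (n + 1), fun s => f (bernsteinNode R n k) • bernsteinWeight R n k s := by
      ext s
      simp [bernsteinApproximation.apply, bernsteinWeight, bernsteinNode, F, mul_comm]
    rw [this, cfc_sum (fun (k : Fin (n + 1)) s => f (bernsteinNode R n k) • bernsteinWeight R n k s)
      b Finset.univ fun k _ => by have := hc k; fun_prop]
    exact Finset.sum_congr rfl fun k _ => (cfc_smul _ _ _ (hc k).continuousOn).symm
  simp_rw [hsum]
  refine tendsto_cfc_fun ?_ (Eventually.of_forall fun n => ?_)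
  · have h := ContinuousMap.tendsto_iff_tendstoUniformly.1 (bernsteinApproximation_uniform F)
    rw [Metric.tendstoUniformly_iff] at h
    rw [Metric.tendstoUniformlyOn_iff]
    intro ε hε
    filter_upwards [h ε hε] with n hn s hs
    have hs' := spectrum_subset_Icc hb hs
    have h1 : s / R ∈ Set.Icc (0 : ℝ) 1 :=
      ⟨div_nonneg hs'.1 hR0.le, (div_le_one hR0).2 hs'.2⟩
    have h2 := hn (Set.projIcc 0 1 zero_le_one (s / R))
    have h3 : F (Set.projIcc 0 1 zero_le_one (s / R)) = f s := by
      simp only [F, ContinuousMap.coe_mk]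
      rw [Set.projIcc_of_mem _ h1]
      congr 1
      field_simp
    rwa [h3] at h2
  · exact ((map_continuous _).comp
      (continuous_projIcc.comp (continuous_id.div_const R))).continuousOn

omit [StarOrderedRing M] in
lemma SymSemigroup.continuous_T (S : SymSemigroup τ) (t : ℝ≥0) : Continuous (S.T t) :=
  (LinearMap.mkContinuous (S.T t) 1 fun a => by
    rw [one_mul]; exact S.contraction' t a).continuous

lemma SymSemigroup.T_one_le (S : SymSemigroup τ) (t : ℝ≥0) : S.T t 1 ≤ 1 := by
  rw [← CStarAlgebra.norm_le_one_iff_of_nonneg _ (S.positive' t 1 zero_le_one)]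
  refine (S.contraction' t 1).trans ?_
  rw [CStarAlgebra.norm_le_one_iff_of_nonneg _ zero_le_one]

omit [StarOrderedRing M] in
lemma SymSemigroup.T_real_smul (S : SymSemigroup τ) (t : ℝ≥0) (r : ℝ) (a : M) :
    S.T t (r • a) = r • S.T t a := by
  rw [← Complex.coe_smul, map_smul, Complex.coe_smul]

omit [StarOrderedRing M] in
lemma trace_real_smul_re (r : ℝ) (a : M) : (τ (r • a)).re = r * (τ a).re := by
  rw [← Complex.coe_smul, map_smul, smul_eq_mul, Complex.re_ofReal_mul]

lemma SymSemigroup.re_trace_cfc_comm (S : SymSemigroup τ) (t : ℝ≥0) (b : M) (f g : ℝ → ℝ) :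
    (τ (cfc f b * S.T t (cfc g b))).re = (τ (cfc g b * S.T t (cfc f b))).re := by
  have h1 : IsSelfAdjoint (cfc g b) := cfc_predicate g b
  have h2 : IsSelfAdjoint (cfc f b) := cfc_predicate f b
  have h := S.symmetric' t (cfc g b) (cfc f b)
  rw [h2.star_eq] at h
  rw [← h, ← Complex.conj_re, ← Complex.star_def, ← map_star τ, star_mul, star_star, h1.star_eq]

/-- The forms of the semigroup on the functional calculus of `b` are limits of finite Dirichlet
forms: the conductances are `τ(φ_j T_t φ_k) / 2` and the killing rates `τ(φ_j (1 - T_t 1))`, where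
`φ_j` are the Bernstein weights evaluated at `b`. -/
lemma SymSemigroup.exists_discretization (hτ : ∀ a c : M, τ (a * c) = τ (c * a))
    (S : SymSemigroup τ) (t : ℝ≥0) {b : M} (hb : 0 ≤ b) :
    ∃ (p : ∀ n : ℕ, Fin (n + 1) → ℝ) (κ : ∀ n : ℕ, Fin (n + 1) → ℝ)
      (w : ∀ n : ℕ, Fin (n + 1) → Fin (n + 1) → ℝ),
      (∀ n j, p n j ∈ Set.Icc 0 (‖b‖ + 1)) ∧ (∀ n j, 0 ≤ κ n j) ∧ (∀ n j k, 0 ≤ w n j k) ∧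
      ∀ f g : ℝ → ℝ, Continuous f → Continuous g →
        Tendsto (fun n => ∑ j, κ n j * (f (p n j) * g (p n j))
          + ∑ j, ∑ k, w n j k * ((f (p n j) - f (p n k)) * (g (p n j) - g (p n k)))) atTop
          (𝓝 (S.form t (emb τ (cfc f b)) (emb τ (cfc g b)))) := by
  set R := ‖b‖ + 1
  have hR0 : 0 < R := by positivity
  let p := bernsteinNode R
  let a : ∀ n : ℕ, Fin (n + 1) → M := fun n k => cfc (bernsteinWeight R n k) b
  have ha : ∀ n k, 0 ≤ a n k := fun n k => cfc_bernsteinWeight_nonneg b R n k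
  have hlim : ∀ f : ℝ → ℝ, Continuous f →
      Tendsto (fun n => ∑ k, f (p n k) • a n k) atTop (𝓝 (cfc f b)) :=
    fun f hf => tendsto_sum_cfc_bernsteinWeight hb hf
  let B : ∀ n : ℕ, Fin (n + 1) → Fin (n + 1) → ℝ := fun n j k => (τ (a n j * S.T t (a n k))).re
  have hcτ : Continuous τ := map_continuous τ
  have hcT := S.continuous_T t
  have hB : ∀ f g : ℝ → ℝ, Continuous f → Continuous g →
      Tendsto (fun n => ∑ j, ∑ k, B n j k * (f (p n j) * g (p n k))) atTop
        (𝓝 (τ (cfc f b * S.T t (cfc g b))).re) := by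
    intro f g hf hg
    have h1 := ((Complex.continuous_re.comp hcτ).tendsto _).comp
      ((hlim f hf).mul ((hcT.tendsto _).comp (hlim g hg)))
    refine h1.congr fun n => ?_
    simp only [Function.comp_apply, map_sum, Finset.sum_mul_sum, Complex.re_sum,
      S.T_real_smul, smul_mul_assoc, mul_smul_comm, trace_real_smul_re, B]
    refine Finset.sum_congr rfl fun j _ => Finset.sum_congr rfl fun k _ => ?_
    ring
  have hκ : ∀ f : ℝ → ℝ, Continuous f →
      Tendsto (fun n => ∑ j, (τ (a n j * (1 - S.T t 1))).re * f (p n j)) atTop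
        (𝓝 (τ (cfc f b * (1 - S.T t 1))).re) := by
    intro f hf
    have h1 := ((Complex.continuous_re.comp hcτ).tendsto _).comp
      ((hlim f hf).mul_const (1 - S.T t 1))
    refine h1.congr fun n => ?_
    simp only [Function.comp_apply, Finset.sum_mul, map_sum, Complex.re_sum, smul_mul_assoc,
      trace_real_smul_re]
    exact Finset.sum_congr rfl fun j _ => mul_comm _ _
  refine ⟨p, fun n j => (τ (a n j * (1 - S.T t 1))).re, fun n j k => 2⁻¹ * B n j k,
    fun n j => bernsteinNode_mem hR0 n j,
    fun n j => re_trace_mul_nonneg hτ (ha n j) (sub_nonneg.2 (S.T_one_le t)),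
    fun n j k => mul_nonneg (by norm_num)
      (re_trace_mul_nonneg hτ (ha n j) (S.positive' t _ (ha n k))), fun f g hf hg => ?_⟩
  have hfg : Continuous fun s => f s * g s := hf.mul hg
  have hone : cfc (fun _ : ℝ => (1 : ℝ)) b = 1 := cfc_const_one ℝ b
  have hval : S.form t (emb τ (cfc f b)) (emb τ (cfc g b))
      = (τ (cfc (fun s => f s * g s) b * (1 - S.T t 1))).re
        + 2⁻¹ * ((τ (cfc (fun s => f s * g s) b * S.T t (cfc (fun _ : ℝ => (1 : ℝ)) b))).re
          + (τ (cfc (fun _ : ℝ => (1 : ℝ)) b * S.T t (cfc (fun s => f s * g s) b))).re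
          - (τ (cfc f b * S.T t (cfc g b))).re - (τ (cfc g b * S.T t (cfc f b))).re) := by
    have hsa : IsSelfAdjoint (cfc f b) := cfc_predicate f b
    have hmul : cfc (fun s => f s * g s) b = cfc f b * cfc g b :=
      cfc_mul f g b hf.continuousOn hg.continuousOn
    rw [S.re_trace_cfc_comm t b g f, S.re_trace_cfc_comm t b (fun _ => 1), hone,
      SymSemigroup.form, S.T2_emb, ← emb_sub, inner_emb, hsa.star_eq, mul_sub, mul_sub, mul_one,
      map_sub, map_sub, Complex.sub_re, Complex.sub_re, hmul]
    ring
  rw [hval]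
  refine ((hκ _ hfg).add (((((hB _ _ hfg continuous_const).add
    (hB _ _ continuous_const hfg)).sub (hB f g hf hg)).sub (hB g f hg hf)).const_mul 2⁻¹)).congr
    fun n => ?_
  congr 1
  simp only [← Finset.sum_add_distrib, ← Finset.sum_sub_distrib, Finset.mul_sum]
  refine Finset.sum_congr rfl fun j _ => Finset.sum_congr rfl fun k _ => ?_
  ring

/-- Inequalities between the forms on the functional calculus of `b` follow from pointwise
inequalities. -/
lemma SymSemigroup.sum_form_nonneg (hτ : ∀ a c : M, τ (a * c) = τ (c * a))
    (S : SymSemigroup τ) (t : ℝ≥0) {b : M} (hb : 0 ≤ b) {ι : Type*} [Fintype ι] (c : ι → ℝ)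
    (f g : ι → ℝ → ℝ) (hf : ∀ i, Continuous (f i)) (hg : ∀ i, Continuous (g i))
    (hdiag : ∀ s ∈ Set.Icc 0 (‖b‖ + 1), 0 ≤ ∑ i, c i * (f i s * g i s))
    (hoff : ∀ s ∈ Set.Icc 0 (‖b‖ + 1), ∀ r ∈ Set.Icc 0 (‖b‖ + 1),
      0 ≤ ∑ i, c i * ((f i s - f i r) * (g i s - g i r))) :
    0 ≤ ∑ i, c i * S.form t (emb τ (cfc (f i) b)) (emb τ (cfc (g i) b)) := by
  obtain ⟨p, κ, w, hp, hκ, hw, hlim⟩ := S.exists_discretization hτ t hb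
  refine ge_of_tendsto' (tendsto_finsetSum Finset.univ fun i _ =>
    (hlim (f i) (g i) (hf i) (hg i)).const_mul (c i)) fun n => ?_
  have h1 : ∀ j, ∑ i, c i * (κ n j * (f i (p n j) * g i (p n j)))
      = κ n j * ∑ i, c i * (f i (p n j) * g i (p n j)) := fun j => by
    rw [Finset.mul_sum]; exact Finset.sum_congr rfl fun i _ => by ring
  have h2 : ∀ j k, ∑ i, c i * (w n j k * ((f i (p n j) - f i (p n k)) *
        (g i (p n j) - g i (p n k))))
      = w n j k * ∑ i, c i * ((f i (p n j) - f i (p n k)) * (g i (p n j) - g i (p n k))) :=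
    fun j k => by
      rw [Finset.mul_sum]; exact Finset.sum_congr rfl fun i _ => by ring
  simp only [mul_add, Finset.mul_sum, Finset.sum_add_distrib]
  refine add_nonneg ?_ ?_
  · rw [Finset.sum_comm]
    refine Finset.sum_nonneg fun j _ => ?_
    rw [h1]
    exact mul_nonneg (hκ n j) (hdiag _ (hp n j))
  · rw [Finset.sum_comm]
    refine Finset.sum_nonneg fun j _ => ?_
    rw [Finset.sum_comm]
    refine Finset.sum_nonneg fun k _ => ?_
    rw [h2]
    exact mul_nonneg (hw n j k) (hoff _ (hp n j) _ (hp n k))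

/-! ### Truncations of a strictly positive element -/

lemma lmul_mul (τ : M →ₚ[ℂ] ℂ) (a c : M) (ξ : L2 τ) : lmul τ (a * c) ξ = lmul τ a (lmul τ c ξ) := by
  simp only [lmul, map_mul]; rfl

lemma norm_lmul_le (τ : M →ₚ[ℂ] ℂ) (a : M) (ξ : L2 τ) : ‖lmul τ a ξ‖ ≤ ‖a‖ * ‖ξ‖ :=
  (τ.gnsStarAlgHom a).le_of_opNorm_le (NonUnitalStarAlgHom.norm_apply_le τ.gnsStarAlgHom a) ξ

lemma inner_lmul_lmul (τ : M →ₚ[ℂ] ℂ) (a c : M) (ξ η : L2 τ) :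
    ⟪lmul τ a ξ, lmul τ c η⟫_ℂ = ⟪ξ, lmul τ (star a * c) η⟫_ℂ := by
  rw [lmul_mul]
  simp only [lmul]
  rw [map_star, ContinuousLinearMap.star_eq_adjoint, ContinuousLinearMap.adjoint_inner_right]

lemma norm_lmul_le_of_star_mul_le (τ : M →ₚ[ℂ] ℂ) {a c : M} (h : star a * a ≤ star c * c)
    (ξ : L2 τ) : ‖lmul τ a ξ‖ ≤ ‖lmul τ c ξ‖ := by
  obtain ⟨d, hd⟩ := CStarAlgebra.nonneg_iff_eq_star_mul_self.1 (sub_nonneg.2 h)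
  have hn : ∀ e : M, ‖lmul τ e ξ‖ ^ 2 = (⟪ξ, lmul τ (star e * e) ξ⟫_ℂ).re := fun e => by
    rw [← inner_lmul_lmul, inner_self_eq_norm_sq_to_K]; norm_cast
  have h2 : ‖lmul τ c ξ‖ ^ 2 - ‖lmul τ a ξ‖ ^ 2 = ‖lmul τ d ξ‖ ^ 2 := by
    rw [hn, hn, hn, ← hd, ← Complex.sub_re, ← inner_sub_right]
    simp [lmul]
  exact le_of_sq_le_sq (by nlinarith [sq_nonneg ‖lmul τ d ξ‖]) (norm_nonneg _)

lemma norm_lmul_cfc_le (τ : M →ₚ[ℂ] ℂ) {b : M} {f g : ℝ → ℝ}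
    (hf : ContinuousOn f (spectrum ℝ b)) (hg : ContinuousOn g (spectrum ℝ b))
    (h : ∀ s ∈ spectrum ℝ b, |f s| ≤ |g s|) (ξ : L2 τ) :
    ‖lmul τ (cfc f b) ξ‖ ≤ ‖lmul τ (cfc g b) ξ‖ := by
  refine norm_lmul_le_of_star_mul_le τ ?_ ξ
  have h1 : IsSelfAdjoint (cfc f b) := cfc_predicate f b
  have h2 : IsSelfAdjoint (cfc g b) := cfc_predicate g b
  rw [h1.star_eq, h2.star_eq, ← cfc_mul f f b hf hf, ← cfc_mul g g b hg hg]
  refine cfc_mono (fun s hs => ?_) (hf.mul hf) (hg.mul hg)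
  exact abs_le_iff_mul_self_le.1 (h s hs)

lemma norm_emb_star (hτ : ∀ a c : M, τ (a * c) = τ (c * a)) (a : M) :
    ‖emb τ (star a)‖ = ‖emb τ a‖ := by
  have hn : ∀ e : M, ‖emb τ e‖ ^ 2 = (τ (star e * e)).re := fun e => by
    rw [← inner_emb, inner_self_eq_norm_sq_to_K]; norm_cast
  refine (sq_eq_sq₀ (norm_nonneg _) (norm_nonneg _)).1 ?_
  rw [hn, hn, star_star, hτ]

/-- The level of the truncation `truncPow b r n`, in terms of `s = x⁻¹`. -/
def truncLevel (n : ℕ) : ℝ := ((n : ℝ) + 1)⁻¹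

lemma truncLevel_pos (n : ℕ) : 0 < truncLevel n := by unfold truncLevel; positivity

lemma tendsto_truncLevel : Tendsto truncLevel atTop (𝓝 0) := by
  unfold truncLevel
  simpa only [one_div] using tendsto_one_div_add_atTop_nhds_zero_nat (𝕜 := ℝ)

lemma max_truncLevel_pos (s : ℝ) (n : ℕ) : 0 < max s (truncLevel n) :=
  lt_max_of_lt_right (truncLevel_pos n)

lemma continuous_max_truncLevel_rpow (n : ℕ) (r : ℝ) :
    Continuous fun s : ℝ => (max s (truncLevel n)) ^ r :=
  (continuous_id.max continuous_const).rpow_const fun s => Or.inl (max_truncLevel_pos s n).ne'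

lemma continuous_max_truncLevel_inv (n : ℕ) :
    Continuous fun s : ℝ => (max s (truncLevel n))⁻¹ :=
  (continuous_id.max continuous_const).inv₀ fun s => (max_truncLevel_pos s n).ne'

/-- The function `1 - s min(s⁻¹, n + 1)`, which tends to the indicator function of `{0}`. -/
def truncDefect (n : ℕ) (s : ℝ) : ℝ := 1 - s * (max s (truncLevel n))⁻¹

lemma continuous_truncDefect (n : ℕ) : Continuous (truncDefect n) :=
  continuous_const.sub (continuous_id.mul (continuous_max_truncLevel_inv n))

lemma truncDefect_nonneg (n : ℕ) (s : ℝ) : 0 ≤ truncDefect n s := by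
  rw [truncDefect, sub_nonneg, ← div_eq_mul_inv, div_le_one (max_truncLevel_pos s n)]
  exact le_max_left _ _

lemma truncDefect_le_one (n : ℕ) {s : ℝ} (hs : 0 ≤ s) : truncDefect n s ≤ 1 := by
  have := (max_truncLevel_pos s n).le
  rw [truncDefect, sub_le_self_iff]
  positivity

lemma truncDefect_mul_le (n : ℕ) {s : ℝ} (hs : 0 ≤ s) : truncDefect n s * s ≤ truncLevel n := by
  rcases le_total s (truncLevel n) with h | h
  · exact (mul_le_of_le_one_left hs (truncDefect_le_one n hs)).trans h
  · have : s ≠ 0 := ((truncLevel_pos n).trans_le h).ne'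
    rw [truncDefect, max_eq_left h, mul_inv_cancel₀ this, sub_self, zero_mul]
    exact (truncLevel_pos n).le

variable {x : L2 τ} {b : M}

lemma IsStrictlyPositiveWithInverse.lmul_mul_inv (hx : IsStrictlyPositiveWithInverse τ x b)
    (c : M) : lmul τ (c * b) x = emb τ c := by
  rw [lmul_mul, hx.inv_mul, lmul_emb, mul_one]

/-- The operator `b` is injective on `L_2(M)`: the spectral projection of `b` at `0` vanishes. By
traciality it is enough to see that it vanishes at `1`. -/
lemma IsStrictlyPositiveWithInverse.tendsto_lmul_truncDefect
    (hτ : ∀ a c : M, τ (a * c) = τ (c * a)) (hx : IsStrictlyPositiveWithInverse τ x b) (ξ : L2 τ) :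
    Tendsto (fun n => lmul τ (cfc (truncDefect n) b) ξ) atTop (𝓝 0) := by
  have hsp : ∀ s ∈ spectrum ℝ b, 0 ≤ s := fun s hs => spectrum_nonneg_of_nonneg hx.inv_nonneg hs
  have hsa : ∀ n, IsSelfAdjoint (cfc (truncDefect n) b) := fun n => cfc_predicate _ b
  have h1 : ∀ n, ‖cfc (truncDefect n) b‖ ≤ 1 := fun n =>
    norm_cfc_le zero_le_one fun s hs => by
      rw [Real.norm_of_nonneg (truncDefect_nonneg n s)]
      exact truncDefect_le_one n (hsp s hs)
  have h2 : ∀ n, ‖emb τ (cfc (truncDefect n) b)‖ ≤ truncLevel n * ‖x‖ := by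
    intro n
    rw [← hx.lmul_mul_inv]
    refine (norm_lmul_le τ _ x).trans ?_
    gcongr
    have hbid : cfc (truncDefect n) b * b = cfc (fun s => truncDefect n s * s) b := by
      have hb : IsSelfAdjoint b := .of_nonneg hx.inv_nonneg
      nth_rewrite 2 [← cfc_id' ℝ b]
      exact (cfc_mul _ _ b (continuous_truncDefect n).continuousOn continuousOn_id).symm
    rw [hbid]
    refine norm_cfc_le (truncLevel_pos n).le fun s hs => ?_
    rw [Real.norm_of_nonneg (mul_nonneg (truncDefect_nonneg n s) (hsp s hs))]
    exact truncDefect_mul_le n (hsp s hs)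
  -- `‖P a‖_2 = ‖a* P‖_2 ≤ ‖a‖ ‖P‖_2` for self-adjoint `P`, by traciality
  -- `‖P a‖_2 = ‖a* P‖_2 ≤ ‖a‖ ‖P‖_2` for self-adjoint `P`, by traciality
  -- `‖P a‖_2 = ‖a* P‖_2 ≤ ‖a‖ ‖P‖_2` for self-adjoint `P`, by traciality
  -- `‖P a‖_2 = ‖a* P‖_2 ≤ ‖a‖ ‖P‖_2` for self-adjoint `P`, by traciality
  -- `‖P a‖_2 = ‖a* P‖_2 ≤ ‖a‖ ‖P‖_2` for self-adjoint `P`, by traciality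
  have h3 : ∀ a : M, Tendsto (fun n => lmul τ (cfc (truncDefect n) b) (emb τ a)) atTop (𝓝 0) := by
    intro a
    have h4 : Tendsto (fun n => ‖a‖ * (truncLevel n * ‖x‖)) atTop (𝓝 0) := by
      simpa using (tendsto_truncLevel.mul_const ‖x‖).const_mul ‖a‖
    refine squeeze_zero_norm (fun n => ?_) h4
    rw [lmul_emb, ← norm_emb_star hτ, star_mul, (hsa n).star_eq, ← lmul_emb, ← norm_star a]
    exact (norm_lmul_le τ _ _).trans (by gcongr; exact h2 n)
  rw [Metric.tendsto_atTop]
  intro ε hε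
  obtain ⟨a, ha⟩ := (denseRange_emb τ).exists_dist_lt ξ (half_pos hε)
  obtain ⟨N, hN⟩ := Metric.tendsto_atTop.1 (h3 a) (ε / 2) (half_pos hε)
  refine ⟨N, fun n hn => ?_⟩
  have h5 := hN n hn
  rw [dist_zero_right] at h5 ⊢
  rw [dist_eq_norm] at ha
  have h6 : lmul τ (cfc (truncDefect n) b) ξ = lmul τ (cfc (truncDefect n) b) (ξ - emb τ a)
      + lmul τ (cfc (truncDefect n) b) (emb τ a) := by
    simp only [lmul, map_sub, sub_add_cancel]
  rw [h6]
  calc _ ≤ ‖lmul τ (cfc (truncDefect n) b) (ξ - emb τ a)‖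
        + ‖lmul τ (cfc (truncDefect n) b) (emb τ a)‖ := norm_add_le _ _
    _ < ε / 2 + ε / 2 := by
        have := (norm_lmul_le τ (cfc (truncDefect n) b) (ξ - emb τ a)).trans
          (mul_le_of_le_one_left (norm_nonneg _) (h1 n))
        linarith
    _ = ε := add_halves ε

omit [PartialOrder M] [StarOrderedRing M] in
lemma truncPow_eq (b : M) (r : ℝ) (n : ℕ) :
    truncPow b r n = cfc (fun s : ℝ => (max s (truncLevel n)) ^ (-r)) b := rfl

/-- The bounded powers `min(x, n + 1) ^ r` converge to `x ^ r` in `L_2(M)`. -/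
lemma IsStrictlyPositiveWithInverse.tendsto_emb_truncPow
    (hτ : ∀ a c : M, τ (a * c) = τ (c * a)) (hx : IsStrictlyPositiveWithInverse τ x b)
    {r : ℝ} (h0 : 0 ≤ r) (h1 : r ≤ 1) :
    Tendsto (fun n => emb τ (truncPow b r n)) atTop (𝓝 (powL2 τ x b r)) := by
  have hsp : ∀ s ∈ spectrum ℝ b, 0 ≤ s := fun s hs => spectrum_nonneg_of_nonneg hx.inv_nonneg hs
  have hsa : IsSelfAdjoint b := .of_nonneg hx.inv_nonneg
  set C := (‖b‖ + 1) ^ (1 - r)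
  have hC : 0 ≤ C := by positivity
  have hpow : Continuous fun s : ℝ => s ^ (1 - r) := Real.continuous_rpow_const (by linarith)
  have hdiff : ∀ n, powL2 τ x b r - emb τ (truncPow b r n)
      = lmul τ (cfc (fun s : ℝ => s ^ (1 - r) - (max s (truncLevel n)) ^ (-r) * s) b) x := by
    intro n
    have hc := continuous_max_truncLevel_rpow n (-r)
    rw [cfc_sub (fun s : ℝ => s ^ (1 - r)) (fun s => (max s (truncLevel n)) ^ (-r) * s) b
        hpow.continuousOn (hc.mul continuous_id).continuousOn,
      cfc_mul (fun s : ℝ => (max s (truncLevel n)) ^ (-r)) (fun s => s) b hc.continuousOn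
        continuousOn_id, cfc_id' ℝ b, ← truncPow_eq, ← CFC.rpow_eq_cfc_real hx.inv_nonneg,
      ← hx.lmul_mul_inv, powL2]
    simp [lmul]
  have hbound : ∀ n, ‖powL2 τ x b r - emb τ (truncPow b r n)‖
      ≤ ‖(C : ℂ) • lmul τ (cfc (truncDefect n) b) x‖ := by
    intro n
    have hc := continuous_max_truncLevel_rpow n (-r)
    have hd := continuous_truncDefect n
    have hsm : (C : ℂ) • lmul τ (cfc (truncDefect n) b) x
        = lmul τ (cfc (fun s => C * truncDefect n s) b) x := by
      rw [cfc_const_mul C (truncDefect n) b hd.continuousOn, ← Complex.coe_smul]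
      simp only [lmul, map_smul]
      rfl
    rw [hsm, hdiff]
    refine norm_lmul_cfc_le τ (f := fun s => s ^ (1 - r) - (max s (truncLevel n)) ^ (-r) * s)
      (g := fun s => C * truncDefect n s) (hpow.sub (hc.mul continuous_id)).continuousOn
      (continuous_const.mul hd).continuousOn (fun s hs => ?_) x
    have hs0 := hsp s hs
    have hsR := (spectrum_subset_Icc hx.inv_nonneg hs).2
    rw [abs_of_nonneg (mul_nonneg hC (truncDefect_nonneg n s))]
    have hsC : s ^ (1 - r) ≤ C := Real.rpow_le_rpow hs0 hsR (by linarith)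
    -- at `s = 0` the case `r = 1` matters: there `0 ^ (1 - r) = 1`
    -- at `s = 0` the case `r = 1` matters: there `0 ^ (1 - r) = 1`
    -- at `s = 0` the case `r = 1` matters: there `0 ^ (1 - r) = 1`
    -- at `s = 0` the case `r = 1` matters: there `0 ^ (1 - r) = 1`
    -- at `s = 0` the case `r = 1` matters: there `0 ^ (1 - r) = 1`
    rcases hs0.eq_or_lt with rfl | hs0
    · simpa [truncDefect, abs_of_nonneg (Real.rpow_nonneg le_rfl (1 - r))] using hsC
    · have hm := max_truncLevel_pos s n
      set m := max s (truncLevel n) with hmdef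
      have hsm : s / m ≤ 1 := (div_le_one hm).2 (le_max_left _ _)
      have e : s ^ (1 - r) - m ^ (-r) * s = s ^ (1 - r) * (1 - (s / m) ^ r) := by
        have : s ^ (1 - r) * s ^ r = s := by rw [← Real.rpow_add hs0]; simp
        rw [Real.div_rpow hs0.le hm.le, Real.rpow_neg hm.le, mul_sub, ← mul_div_assoc, this]
        ring
      -- `1 - (s / m) ^ r ≤ 1 - s / m`, which is where `r ≤ 1` enters
      -- `1 - (s / m) ^ r ≤ 1 - s / m`, which is where `r ≤ 1` enters
      -- `1 - (s / m) ^ r ≤ 1 - s / m`, which is where `r ≤ 1` enters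
      -- `1 - (s / m) ^ r ≤ 1 - s / m`, which is where `r ≤ 1` enters
      -- `1 - (s / m) ^ r ≤ 1 - s / m`, which is where `r ≤ 1` enters
      have h3 : (s / m) ^ r ≤ 1 := Real.rpow_le_one (by positivity) hsm h0
      have h4 : s / m ≤ (s / m) ^ r := by
        conv_lhs => rw [← Real.rpow_one (s / m)]
        exact Real.rpow_le_rpow_of_exponent_ge (by positivity) hsm h1
      have hs1 : 0 ≤ s ^ (1 - r) := by positivity
      rw [e, abs_of_nonneg (mul_nonneg hs1 (by linarith)), truncDefect, ← hmdef,
        ← div_eq_mul_inv]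
      exact mul_le_mul hsC (by linarith) (by linarith) hC
  have hlim : Tendsto (fun n => ‖(C : ℂ) • lmul τ (cfc (truncDefect n) b) x‖) atTop (𝓝 0) := by
    simpa using ((hx.tendsto_lmul_truncDefect hτ x).const_smul (C : ℂ)).norm
  have := squeeze_zero_norm hbound hlim
  simpa using this.const_sub (powL2 τ x b r)

lemma powL2_one (hb : 0 ≤ b) : powL2 τ x b 1 = x := by
  rw [powL2, sub_self, CFC.rpow_zero b hb]
  simp [lmul]

/-! ### Comparison of the forms of the powers of the truncations -/

/-- `min(x, n + 1)` as a function of `s = x⁻¹`. -/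
def truncInv (n : ℕ) (s : ℝ) : ℝ := (max s (truncLevel n))⁻¹

lemma truncInv_pos (n : ℕ) (s : ℝ) : 0 < truncInv n s := inv_pos.2 (max_truncLevel_pos s n)

lemma truncInv_le (n : ℕ) (s : ℝ) : truncInv n s ≤ n + 1 := by
  have h : truncLevel n ≤ max s (truncLevel n) := le_max_right _ _
  have := inv_anti₀ (truncLevel_pos n) h
  rwa [truncLevel, inv_inv] at this

lemma le_truncInv (n : ℕ) {s R : ℝ} (hs : s ≤ R) (hR : 1 ≤ R) : R⁻¹ ≤ truncInv n s := by
  refine inv_anti₀ (max_truncLevel_pos s n) (max_le hs (le_trans ?_ hR))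
  exact inv_le_one_of_one_le₀ (by linarith [Nat.cast_nonneg (α := ℝ) n])

lemma truncInv_eq_min {n m : ℕ} (h : n ≤ m) (s : ℝ) :
    truncInv n s = min (truncInv m s) (n + 1) := by
  have hl : truncLevel m ≤ truncLevel n := by
    unfold truncLevel
    gcongr
  have h1 : max s (truncLevel n) = max (max s (truncLevel m)) (truncLevel n) := by
    rw [max_assoc, max_eq_right hl]
  unfold truncInv
  rw [h1]
  rcases le_total (max s (truncLevel m)) (truncLevel n) with h2 | h2
  · have := inv_anti₀ (max_truncLevel_pos s m) h2
    rw [max_eq_right h2, min_eq_right (by simpa [truncLevel] using this)]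
    simp [truncLevel]
  · have := inv_anti₀ (truncLevel_pos n) h2
    rw [max_eq_left h2, min_eq_left (by simpa [truncLevel] using this)]

lemma continuous_truncInv_rpow (n : ℕ) (r : ℝ) : Continuous fun s => truncInv n s ^ r :=
  (continuous_max_truncLevel_inv n).rpow_const fun s => Or.inl (truncInv_pos n s).ne'

omit [PartialOrder M] [StarOrderedRing M] in
lemma truncPow_eq_cfc_truncInv (b : M) (r : ℝ) (n : ℕ) :
    truncPow b r n = cfc (fun s => truncInv n s ^ r) b := by
  rw [truncPow_eq]
  refine cfc_congr fun s _ => ?_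
  have h := (max_truncLevel_pos s n).le
  simp only [truncInv]
  rw [Real.rpow_neg h, Real.inv_rpow h]

/-- The case of two terms of `SymSemigroup.sum_form_nonneg`, for powers of truncations. -/
lemma SymSemigroup.mul_form_le_mul_form (hτ : ∀ a c : M, τ (a * c) = τ (c * a))
    (S : SymSemigroup τ) (t : ℝ≥0) {b : M} (hb : 0 ≤ b) (c c' r₁ r₂ r₃ r₄ : ℝ) (i j k l : ℕ)
    (hdiag : ∀ s ≤ ‖b‖ + 1, c * (truncInv i s ^ r₁ * truncInv j s ^ r₂)
      ≤ c' * (truncInv k s ^ r₃ * truncInv l s ^ r₄))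
    (hoff : ∀ s ≤ ‖b‖ + 1, ∀ r ≤ ‖b‖ + 1,
      c * ((truncInv i s ^ r₁ - truncInv i r ^ r₁) * (truncInv j s ^ r₂ - truncInv j r ^ r₂))
      ≤ c' * ((truncInv k s ^ r₃ - truncInv k r ^ r₃) *
        (truncInv l s ^ r₄ - truncInv l r ^ r₄))) :
    c * S.form t (emb τ (truncPow b r₁ i)) (emb τ (truncPow b r₂ j))
      ≤ c' * S.form t (emb τ (truncPow b r₃ k)) (emb τ (truncPow b r₄ l)) := by
  have h := S.sum_form_nonneg hτ t hb (ι := Fin 2) ![c', -c]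
    ![fun s => truncInv k s ^ r₃, fun s => truncInv i s ^ r₁]
    ![fun s => truncInv l s ^ r₄, fun s => truncInv j s ^ r₂]
    (by simp [Fin.forall_fin_two, continuous_truncInv_rpow])
    (by simp [Fin.forall_fin_two, continuous_truncInv_rpow])
    (fun s hs => by simpa [Fin.sum_univ_two] using hdiag s hs.2)
    (fun s hs r hr => by simpa [Fin.sum_univ_two] using hoff s hs.2 r hr.2)
  simp only [truncPow_eq_cfc_truncInv]
  simpa [Fin.sum_univ_two] using h

/-- With `x_n = min(x, n + 1)`, replacing `x_k ^ β` by `x_n ^ β` costs at most the energy lost in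
passing from `x_m` to `x_n`: the defect
`(u - v)² - (u ^ α - v ^ α) (u ^ β - v ^ β) = powGap γ u v ^ 2` is smaller for the truncations. This
bound makes the interchange of limits possible. -/
lemma SymSemigroup.form_sub_form_le (hτ : ∀ a c : M, τ (a * c) = τ (c * a))
    (S : SymSemigroup τ) (t : ℝ≥0) {b : M} (hb : 0 ≤ b) {γ : ℝ} (h0 : 0 ≤ γ) (h1 : γ ≤ 1)
    {n k m : ℕ} (hnk : n ≤ k) (hkm : k ≤ m) :
    S.form t (emb τ (truncPow b (1 + γ) k)) (emb τ (truncPow b (1 - γ) m))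
      - S.form t (emb τ (truncPow b (1 + γ) n)) (emb τ (truncPow b (1 - γ) m))
      ≤ S.form t (emb τ (truncPow b 1 m)) (emb τ (truncPow b 1 m))
        - S.form t (emb τ (truncPow b 1 n)) (emb τ (truncPow b 1 n)) := by
  have hn : (0 : ℝ) < n + 1 := by positivity
  have hk : (0 : ℝ) < k + 1 := by positivity
  have hkn : (n : ℝ) + 1 ≤ k + 1 := by gcongr
  have hprod : ∀ u : ℝ, 0 < u → u ^ (1 + γ) * u ^ (1 - γ) = u * u := fun u hu => by
    rw [← Real.rpow_add hu, add_add_sub_cancel, ← sq, ← Real.rpow_natCast]; norm_num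
  have h := S.sum_form_nonneg hτ t hb (ι := Fin 4) ![1, -1, -1, 1]
    ![fun s => truncInv m s ^ (1 : ℝ), fun s => truncInv n s ^ (1 : ℝ),
      fun s => truncInv k s ^ (1 + γ), fun s => truncInv n s ^ (1 + γ)]
    ![fun s => truncInv m s ^ (1 : ℝ), fun s => truncInv n s ^ (1 : ℝ),
      fun s => truncInv m s ^ (1 - γ), fun s => truncInv m s ^ (1 - γ)]
    (by simp [Fin.forall_fin_succ, continuous_truncInv_rpow, -Real.rpow_one])
    (by simp [Fin.forall_fin_succ, continuous_truncInv_rpow, -Real.rpow_one])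
    (fun s _ => by
      have hu := truncInv_pos m s
      have hu' := truncInv_pos n s
      have hk' := truncInv_pos k s
      have e1 : truncInv k s ≤ truncInv m s := by
        rw [truncInv_eq_min hkm]; exact min_le_left _ _
      have e2 : truncInv n s ≤ truncInv m s := by
        rw [truncInv_eq_min (hnk.trans hkm)]; exact min_le_left _ _
      have a1 : truncInv k s ^ (1 + γ) * truncInv m s ^ (1 - γ)
          ≤ truncInv m s ^ (1 + γ) * truncInv m s ^ (1 - γ) := by gcongr
      have a2 : truncInv n s ^ (1 + γ) * truncInv n s ^ (1 - γ)
          ≤ truncInv n s ^ (1 + γ) * truncInv m s ^ (1 - γ) := by gcongr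
      rw [hprod _ hu] at a1
      rw [hprod _ hu'] at a2
      simp [Fin.sum_univ_four]
      linarith)
    (fun s _ r _ => by
      have hu := truncInv_pos m s
      have hv := truncInv_pos m r
      have hu' := lt_min hu hn
      have hv' := lt_min hv hn
      -- a level that does not truncate `u` and `v`
      have a1 := rpow_sub_mul_rpow_min_sub_mono (r := 1 - γ) (s := 1 + γ) (by linarith)
        (by linarith) hu hv hk (le_max_left _ (max (truncInv m s) (truncInv m r)))
      rw [min_eq_left (le_max_of_le_right (le_max_left _ _)),
        min_eq_left (le_max_of_le_right (le_max_right _ _)), rpow_sub_mul_rpow_sub γ hu hv] at a1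
      have a2 := rpow_min_sub_mul_rpow_min_sub_le (r := 1 - γ) (s := 1 + γ) (by linarith)
        (by linarith) hu hv hn
      rw [rpow_sub_mul_rpow_sub γ hu' hv'] at a2
      have a3 := powGap_min_sq_le (N := n + 1) h0 h1 hu hv
      simp only [truncInv_eq_min hkm, truncInv_eq_min (hnk.trans hkm)]
      simp [Fin.sum_univ_four]
      nlinarith)
  simp only [truncPow_eq_cfc_truncInv]
  simp [Fin.sum_univ_four, -Real.rpow_one] at h
  linarith

lemma SymSemigroup.form_trunc_mono (hτ : ∀ a c : M, τ (a * c) = τ (c * a))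
    (S : SymSemigroup τ) (t : ℝ≥0) {b : M} (hb : 0 ≤ b) {γ : ℝ} (h0 : 0 ≤ γ) (h1 : γ ≤ 1)
    {n k m : ℕ} (hnk : n ≤ k) (hkm : k ≤ m) :
    S.form t (emb τ (truncPow b (1 + γ) n)) (emb τ (truncPow b (1 - γ) m))
      ≤ S.form t (emb τ (truncPow b (1 + γ) k)) (emb τ (truncPow b (1 - γ) m)) := by
  have hn : (0 : ℝ) < n + 1 := by positivity
  have hkn : (n : ℝ) + 1 ≤ k + 1 := by gcongr
  have h := S.mul_form_le_mul_form hτ t hb 1 1 (1 + γ) (1 - γ) (1 + γ) (1 - γ) n m k m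
    (fun s _ => by
      have e : truncInv n s ≤ truncInv k s := by
        rw [truncInv_eq_min hnk]; exact min_le_left _ _
      have := truncInv_pos n s
      have := truncInv_pos m s
      rw [one_mul, one_mul]
      gcongr)
    (fun s _ r _ => by
      have a := rpow_sub_mul_rpow_min_sub_mono (r := 1 - γ) (s := 1 + γ) (by linarith)
        (by linarith) (truncInv_pos m s) (truncInv_pos m r) hn hkn
      rw [one_mul, one_mul]
      simp only [truncInv_eq_min hkm, truncInv_eq_min (hnk.trans hkm)]
      linarith)
  simpa using h

lemma SymSemigroup.form_trunc_le (hτ : ∀ a c : M, τ (a * c) = τ (c * a))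
    (S : SymSemigroup τ) (t : ℝ≥0) {b : M} (hb : 0 ≤ b) {γ : ℝ} (h0 : 0 ≤ γ) (h1 : γ ≤ 1)
    {n m : ℕ} (hnm : n ≤ m) :
    S.form t (emb τ (truncPow b (1 + γ) n)) (emb τ (truncPow b (1 - γ) m))
      ≤ S.form t (emb τ (truncPow b 1 m)) (emb τ (truncPow b 1 m)) := by
  refine (S.form_trunc_mono hτ t hb h0 h1 hnm le_rfl).trans ?_
  have h := S.mul_form_le_mul_form hτ t hb 1 1 (1 + γ) (1 - γ) 1 1 m m m m
    (fun s _ => by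
      have hu := truncInv_pos m s
      rw [← Real.rpow_add hu, ← Real.rpow_add hu]
      apply le_of_eq; congr 2; ring)
    (fun s _ r _ => by
      have a := rpow_sub_mul_rpow_sub γ (truncInv_pos m s) (truncInv_pos m r)
      simp only [Real.rpow_one, one_mul]
      nlinarith [sq_nonneg (powGap γ (truncInv m s) (truncInv m r))])
  simpa using h

/-- The lower bound: for `α = 1 - γ` and `β = 1 + γ`,
`αβ (u - v)² ≤ (u ^ α - v ^ α) (u ^ β - v ^ β)`. -/
lemma SymSemigroup.le_form_trunc (hτ : ∀ a c : M, τ (a * c) = τ (c * a))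
    (S : SymSemigroup τ) (t : ℝ≥0) {b : M} (hb : 0 ≤ b) {γ : ℝ} (h0 : 0 ≤ γ) (h1 : γ ≤ 1)
    {n m : ℕ} (hnm : n ≤ m) :
    (1 - γ ^ 2) * S.form t (emb τ (truncPow b 1 n)) (emb τ (truncPow b 1 n))
      ≤ S.form t (emb τ (truncPow b (1 + γ) n)) (emb τ (truncPow b (1 - γ) m)) := by
  have hn : (0 : ℝ) < n + 1 := by positivity
  have h := S.mul_form_le_mul_form hτ t hb (1 - γ ^ 2) 1 1 1 (1 + γ) (1 - γ) n n n m
    (fun s _ => by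
      have hu := truncInv_pos n s
      have e : truncInv n s ≤ truncInv m s := by
        rw [truncInv_eq_min hnm]; exact min_le_left _ _
      have a : truncInv n s ^ (1 - γ) ≤ truncInv m s ^ (1 - γ) := by gcongr
      have p : truncInv n s ^ (1 + γ) * truncInv n s ^ (1 - γ) = truncInv n s ^ 2 := by
        rw [← Real.rpow_add hu, add_add_sub_cancel, ← Real.rpow_natCast]; norm_num
      have q : 0 < truncInv n s ^ (1 + γ) := by positivity
      simp only [Real.rpow_one, one_mul]
      nlinarith [sq_nonneg γ, sq_nonneg (γ * truncInv n s)])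
    (fun s _ r _ => by
      have hu := truncInv_pos m s
      have hv := truncInv_pos m r
      have a := rpow_min_sub_mul_rpow_min_sub_le (r := 1 - γ) (s := 1 + γ) (by linarith)
        (by linarith) hu hv hn
      rw [rpow_sub_mul_rpow_sub γ (lt_min hu hn) (lt_min hv hn)] at a
      have c := powGap_sq_le h0 h1 (lt_min hu hn) (lt_min hv hn)
      simp only [Real.rpow_one, one_mul, truncInv_eq_min hnm]
      linarith)
  simpa using h

lemma SymSemigroup.form_truncPow_self_le (hτ : ∀ a c : M, τ (a * c) = τ (c * a))
    (S : SymSemigroup τ) (t : ℝ≥0) {b : M} (hb : 0 ≤ b) {r K : ℝ} (h0 : 0 ≤ r) (h2 : r ≤ 2)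
    (n : ℕ) (hK : ∀ s ≤ ‖b‖ + 1, truncInv n s ^ (r - 1) ≤ K) :
    S.form t (emb τ (truncPow b r n)) (emb τ (truncPow b r n))
      ≤ (2 * K) ^ 2 * S.form t (emb τ (truncPow b 1 n)) (emb τ (truncPow b 1 n)) := by
  have h := S.mul_form_le_mul_form hτ t hb 1 ((2 * K) ^ 2) r r 1 1 n n n n
    (fun s hs => by
      have hu := truncInv_pos n s
      have e : truncInv n s ^ r = truncInv n s ^ (r - 1) * truncInv n s := by
        rw [Real.rpow_sub hu, Real.rpow_one, div_mul_cancel₀ _ hu.ne']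
      have hp : 0 < truncInv n s ^ (r - 1) := by positivity
      have hle : truncInv n s ^ (r - 1) ≤ 2 * K := by linarith [hK s hs]
      have := pow_le_pow_left₀ hp.le hle 2
      simp only [Real.rpow_one, one_mul]
      rw [e]
      nlinarith [sq_nonneg (truncInv n s)])
    (fun s hs r' hr' => by
      have := sq_rpow_sub_rpow_le h0 h2 (truncInv_pos n s) (truncInv_pos n r') (hK s hs)
        (hK r' hr')
      simp only [Real.rpow_one, one_mul]
      linarith)
  simpa using h

/-- The energy of `min(x, n + 1)` is at most that of `x`. -/
lemma SymSemigroup.form_trunc_self_le (hτ : ∀ a c : M, τ (a * c) = τ (c * a))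
    (S : SymSemigroup τ) (t : ℝ≥0) (hx : IsStrictlyPositiveWithInverse τ x b) (n : ℕ) :
    S.form t (emb τ (truncPow b 1 n)) (emb τ (truncPow b 1 n)) ≤ S.form t x x := by
  have hlim := hx.tendsto_emb_truncPow hτ zero_le_one le_rfl
  rw [powL2_one hx.inv_nonneg] at hlim
  refine ge_of_tendsto (((S.continuous_form_diag t).tendsto x).comp hlim)
    (eventually_ge_atTop n |>.mono fun m hm => ?_)
  simpa using S.le_form_trunc hτ t hx.inv_nonneg le_rfl zero_le_one hm |>.trans
    (S.form_trunc_le hτ t hx.inv_nonneg le_rfl zero_le_one hm)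

/-- The powers in `L_2(M)` of exponent at most `1` have finite energy. -/
lemma SymSemigroup.form_powL2_self_le (hτ : ∀ a c : M, τ (a * c) = τ (c * a))
    (S : SymSemigroup τ) (hx : IsStrictlyPositiveWithInverse τ x b) {r : ℝ} (h0 : 0 ≤ r)
    (h1 : r ≤ 1) :
    ∃ K : ℝ, 0 ≤ K ∧ ∀ t, S.form t (powL2 τ x b r) (powL2 τ x b r) ≤ K * S.form t x x := by
  set R := ‖b‖ + 1
  have hR : 1 ≤ R := by simp [R]
  have hR0 : 0 < R := one_pos.trans_le hR
  refine ⟨(2 * R⁻¹ ^ (r - 1)) ^ 2, sq_nonneg _, fun t => ?_⟩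
  refine le_of_tendsto (((S.continuous_form_diag t).tendsto _).comp
    (hx.tendsto_emb_truncPow hτ h0 h1)) (Eventually.of_forall fun n => ?_)
  refine (S.form_truncPow_self_le hτ t hx.inv_nonneg h0 (by linarith) n fun s hs => ?_).trans
    (mul_le_mul_of_nonneg_left (S.form_trunc_self_le hτ t hx n) (sq_nonneg _))
  exact Real.rpow_le_rpow_of_nonpos (by positivity) (le_truncInv n hs hR) (by linarith)

/-- The bounded powers of exponent between `1` and `2` have finite energy, which need not be
bounded uniformly in the truncation. -/
lemma SymSemigroup.exists_form_truncPow_self_le (hτ : ∀ a c : M, τ (a * c) = τ (c * a))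
    (S : SymSemigroup τ) (hx : IsStrictlyPositiveWithInverse τ x b) {r : ℝ} (h1 : 1 ≤ r)
    (h2 : r ≤ 2) (n : ℕ) :
    ∃ K : ℝ, 0 ≤ K ∧ ∀ t, S.form t (emb τ (truncPow b r n)) (emb τ (truncPow b r n))
      ≤ K * S.form t x x := by
  refine ⟨(2 * (n + 1) ^ (r - 1)) ^ 2, sq_nonneg _, fun t => ?_⟩
  refine (S.form_truncPow_self_le hτ t hx.inv_nonneg (by linarith) h2 n fun s _ => ?_).trans
    (mul_le_mul_of_nonneg_left (S.form_trunc_self_le hτ t hx n) (sq_nonneg _))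
  exact Real.rpow_le_rpow (truncInv_pos n s).le (truncInv_le n s) (by linarith)

/-! ### Passage to the limit -/

/-- If an increasing sequence `g t n` has increments controlled by a deficit `Q t - q t n`, then
its limits as `n → ∞` and as `t → 0` commute. -/
lemma exists_limit_of_deficit {g q : ℝ≥0 → ℕ → ℝ} {Q : ℝ≥0 → ℝ} {E c : ℝ} {d e : ℕ → ℝ}
    (hmono : ∀ t, Monotone (g t)) (hle : ∀ t n, g t n ≤ Q t)
    (hdiff : ∀ t n k, n ≤ k → g t k - g t n ≤ Q t - q t n)
    (hlow : ∀ t n, c * q t n ≤ g t n)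
    (hq : ∀ t, Tendsto (q t) atTop (𝓝 (Q t)))
    (hQ : Tendsto Q (𝓝[>] 0) (𝓝 E))
    (hqe : ∀ n, Tendsto (fun t => q t n) (𝓝[>] 0) (𝓝 (e n))) (hqle : ∀ t n, q t n ≤ e n)
    (hgd : ∀ n, Tendsto (fun t => g t n) (𝓝[>] 0) (𝓝 (d n))) :
    ∃ (G : ℝ≥0 → ℝ) (D : ℝ), (∀ t, Tendsto (g t) atTop (𝓝 (G t))) ∧
      Tendsto G (𝓝[>] 0) (𝓝 D) ∧ Tendsto d atTop (𝓝 D) ∧ c * E ≤ D ∧ D ≤ E := by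
  have hbdd : ∀ t, BddAbove (Set.range (g t)) := fun t =>
    ⟨Q t, by rintro _ ⟨n, rfl⟩; exact hle t n⟩
  have hG : ∀ t, Tendsto (g t) atTop (𝓝 (⨆ n, g t n)) := fun t =>
    tendsto_atTop_ciSup (hmono t) (hbdd t)
  have hdE : ∀ n, d n ≤ E := fun n => le_of_tendsto_of_tendsto' (hgd n) hQ fun t => hle t n
  have hdmono : Monotone d := fun n k hnk =>
    le_of_tendsto_of_tendsto' (hgd n) (hgd k) fun t => hmono t hnk
  have hd : Tendsto d atTop (𝓝 (⨆ n, d n)) :=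
    tendsto_atTop_ciSup hdmono ⟨E, by rintro _ ⟨n, rfl⟩; exact hdE n⟩
  have heE : ∀ n, e n ≤ E := fun n => le_of_tendsto_of_tendsto' (hqe n) hQ fun t => by
    have := hdiff t n n le_rfl
    linarith
  have he : Tendsto e atTop (𝓝 E) := by
    rw [tendsto_order]
    refine ⟨fun a ha => ?_, fun a ha => Eventually.of_forall fun n => (heE n).trans_lt ha⟩
    obtain ⟨t, ht⟩ := (hQ.eventually (lt_mem_nhds ha)).exists
    filter_upwards [(hq t).eventually (lt_mem_nhds ht)] with n hn
    exact hn.trans_le (hqle t n)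
  refine ⟨fun t => ⨆ n, g t n, ⨆ n, d n, hG, ?_, hd, ?_, ?_⟩
  · rw [tendsto_order]
    constructor
    · intro a ha
      obtain ⟨n, hn⟩ := (hd.eventually (lt_mem_nhds ha)).exists
      filter_upwards [(hgd n).eventually (lt_mem_nhds hn)] with t ht
      exact ht.trans_le (le_ciSup (hbdd t) n)
    · intro a ha
      have h1 : Tendsto (fun n => d n + (E - e n)) atTop (𝓝 (⨆ n, d n)) := by
        simpa using hd.add (he.const_sub E)
      obtain ⟨n, hn⟩ := (h1.eventually (gt_mem_nhds ha)).exists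
      have h2 := (hgd n).add (hQ.sub (hqe n))
      filter_upwards [h2.eventually (gt_mem_nhds hn)] with t ht
      refine lt_of_le_of_lt (le_of_tendsto (hG t) ?_) ht
      filter_upwards [eventually_ge_atTop n] with k hk
      have := hdiff t n k hk
      linarith
  · exact le_of_tendsto_of_tendsto' (he.const_mul c) hd fun n =>
      le_of_tendsto_of_tendsto' ((hqe n).const_mul c) (hgd n) fun t => hlow t n
  · exact le_of_tendsto' hd hdE

lemma inner_emb_im (hτ : ∀ a c : M, τ (a * c) = τ (c * a)) {a c : M} (ha : IsSelfAdjoint a)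
    (hc : IsSelfAdjoint c) : (⟪emb τ a, emb τ c⟫_ℂ).im = 0 := by
  rw [inner_emb, ha.star_eq, ← Complex.conj_eq_iff_im, ← Complex.star_def, ← map_star τ, star_mul,
    ha.star_eq, hc.star_eq, hτ]

omit [PartialOrder M] [StarOrderedRing M] in
lemma isSelfAdjoint_truncPow (b : M) (r : ℝ) (n : ℕ) : IsSelfAdjoint (truncPow b r n) :=
  cfc_predicate _ b

lemma trL2_lmul {a : M} (ha : IsSelfAdjoint a) (ξ : L2 τ) :
    trL2 τ (lmul τ a ξ) = ⟪emb τ a, ξ⟫_ℂ := by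
  have h := inner_lmul_lmul τ a 1 (emb τ 1) ξ
  rw [lmul_emb, mul_one, mul_one, ha.star_eq] at h
  rw [trL2, ← h]
  simp [lmul]

/-- The pairings in the definition of the form value are real, as traces of products of two
self-adjoint elements and limits of such. -/
lemma SymSemigroup.inner_truncPow_eq_form (hτ : ∀ a c : M, τ (a * c) = τ (c * a))
    (S : SymSemigroup τ) (t : ℝ≥0) (hx : IsStrictlyPositiveWithInverse τ x b) {r : ℝ}
    (h0 : 0 ≤ r) (h1 : r ≤ 1) (r' : ℝ) (n : ℕ) :
    ⟪emb τ (truncPow b r' n), powL2 τ x b r - S.T2 t (powL2 τ x b r)⟫_ℂ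
      = (S.form t (emb τ (truncPow b r' n)) (powL2 τ x b r) : ℂ) := by
  have hT : ∀ m, IsSelfAdjoint (S.T t (truncPow b r m)) := fun m =>
    .of_nonneg (S.positive' t _ (cfc_nonneg fun s _ =>
      Real.rpow_nonneg (max_truncLevel_pos s m).le _))
  have hc : Continuous fun η => (⟪emb τ (truncPow b r' n), η - S.T2 t η⟫_ℂ).im := by fun_prop
  have him : (⟪emb τ (truncPow b r' n), powL2 τ x b r - S.T2 t (powL2 τ x b r)⟫_ℂ).im = 0 := by
    refine tendsto_nhds_unique ((hc.tendsto _).comp (hx.tendsto_emb_truncPow hτ h0 h1))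
      (tendsto_const_nhds.congr fun m => ?_)
    simp only [Function.comp_apply]
    rw [S.T2_emb, ← emb_sub, inner_emb_im hτ (isSelfAdjoint_truncPow b r' n)
      ((isSelfAdjoint_truncPow b r m).sub (hT m))]
  exact Complex.ext rfl (by simpa using him)

end NCSemigroup

end

open NCSemigroup in
theorem proposition4p4 {M : Type*} [CStarAlgebra M] [PartialOrder M] [StarOrderedRing M]
    [WStarAlgebra M] (τ : M →ₚ[ℂ] ℂ) (hτ : IsNormalFaithfulTrace τ) (S : SymSemigroup τ)
    (x : S.generator.domain) (b : M) (hx : IsStrictlyPositiveWithInverse τ (x : L2 τ) b)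
    (q q' : ℝ) (hq : 2 ≤ q) (hqq' : 1 / q + 1 / q' = 1) :
    ∃ D : ℝ,
      S.HasFormValue b (2 / q') (powL2 τ x b (2 / q)) (D : ℂ) ∧
      (∀ y : S.generator.domain, (y : L2 τ) = powL2 τ x b (2 / q) →
        HasTracePow τ b (2 / q') (S.generator y) (D : ℂ)) ∧
      (D : ℂ) ≤ ((q ^ 2 / (4 * (q - 1)) : ℝ) : ℂ) * ⟪(x : L2 τ), S.generator x⟫_ℂ ∧
      ⟪(x : L2 τ), S.generator x⟫_ℂ ≤ ((q ^ 2 / (4 * (q - 1)) : ℝ) : ℂ) * (D : ℂ) := by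
  have htr := hτ.tracial
  have hb := hx.inv_nonneg
  have hq0 : 0 < q := by linarith
  -- the exponents are `2 / q = 1 - γ` and `2 / q' = 1 + γ`
  obtain ⟨γ, hγ⟩ : ∃ γ : ℝ, γ = 1 - 2 / q := ⟨_, rfl⟩
  have hq2 : 2 / q ≤ 1 := (div_le_one hq0).2 hq
  have hq2' : 0 < 2 / q := by positivity
  have h0 : 0 ≤ γ := by linarith
  have h1 : γ ≤ 1 := by linarith
  have hα : 2 / q = 1 - γ := by linarith
  have hβ : 2 / q' = 1 + γ := by
    have e1 : 2 / q = 2 * (1 / q) := by ring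
    have e2 : 2 / q' = 2 * (1 / q') := by ring
    linarith
  have hconst : (q ^ 2 / (4 * (q - 1))) * (1 - γ ^ 2) = 1 := by
    have : q - 1 ≠ 0 := by linarith
    rw [hγ]; field_simp; ring
  rw [hα, hβ]
  set C := q ^ 2 / (4 * (q - 1))
  have hC0 : 0 ≤ C := div_nonneg (sq_nonneg q) (by linarith)
  have hC1 : 1 ≤ C := by nlinarith [mul_nonneg hC0 (sq_nonneg γ)]
  set y := powL2 τ (x : L2 τ) b (1 - γ) with hy
  let X : ℝ → ℕ → L2 τ := fun r n => emb τ (truncPow b r n)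
  have hX1 : Tendsto (X 1) atTop (𝓝 (x : L2 τ)) := by
    have := hx.tendsto_emb_truncPow htr zero_le_one le_rfl
    rwa [powL2_one hb] at this
  have hXy : Tendsto (X (1 - γ)) atTop (𝓝 y) :=
    hx.tendsto_emb_truncPow htr (by linarith) (by linarith)
  have hformX1 : ∀ t, Tendsto (fun m => S.form t (X 1 m) (X 1 m)) atTop
      (𝓝 (S.form t (x : L2 τ) x)) := fun t => ((S.continuous_form_diag t).tendsto _).comp hX1
  have hformXy : ∀ t ξ, Tendsto (fun m => S.form t ξ (X (1 - γ) m)) atTop (𝓝 (S.form t ξ y)) :=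
    fun t ξ => ((S.continuous_form_right t ξ).tendsto _).comp hXy
  -- the energy of `x`
  obtain ⟨E, hE⟩ : ∃ E : ℝ, E = (⟪(x : L2 τ), S.generator x⟫_ℂ).re := ⟨_, rfl⟩
  have hinner : Tendsto (fun t : ℝ≥0 => ((t : ℝ)⁻¹ : ℂ) * ⟪(x : L2 τ), (x : L2 τ) - S.T2 t x⟫_ℂ)
      (𝓝[>] 0) (𝓝 ⟪(x : L2 τ), S.generator x⟫_ℂ) := by
    refine (tendsto_const_nhds.inner (S.generator_tendsto x)).congr fun t => ?_
    rw [inner_smul_right]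
  have hQ : Tendsto (fun t : ℝ≥0 => (t : ℝ)⁻¹ * S.form t (x : L2 τ) x) (𝓝[>] 0) (𝓝 E) := by
    rw [hE]
    refine ((Complex.continuous_re.tendsto _).comp hinner).congr fun t => ?_
    simp only [Function.comp_apply]
    rw [← Complex.ofReal_inv, Complex.re_ofReal_mul]; rfl
  have him : (⟪(x : L2 τ), S.generator x⟫_ℂ).im = 0 := by
    refine tendsto_nhds_unique ((Complex.continuous_im.tendsto _).comp hinner)
      (tendsto_const_nhds.congr fun t => ?_)
    simp only [Function.comp_apply]
    rw [← Complex.ofReal_inv, Complex.im_ofReal_mul, S.form_self_im, mul_zero]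
  have hEeq : ⟪(x : L2 τ), S.generator x⟫_ℂ = (E : ℂ) := Complex.ext (by simp [hE]) (by simp [him])
  have hxE : ∀ t, S.form t (x : L2 τ) x ≤ t * E := fun t => S.form_self_le_of_tendsto hQ t
  have hE0 : 0 ≤ E := ge_of_tendsto' hQ fun t =>
    mul_nonneg (inv_nonneg.2 t.2) (S.form_self_nonneg t _)
  have henergy : ∀ {ξ : L2 τ} {K : ℝ}, 0 ≤ K → (∀ t, S.form t ξ ξ ≤ K * S.form t (x : L2 τ) x) →
      ∀ t : ℝ≥0, S.form t ξ ξ ≤ t * (K * E) := fun {ξ K} hK h t => by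
    have := mul_le_mul_of_nonneg_left (hxE t) hK
    linarith [h t]
  have hXX : ∀ t n, S.form t (X 1 n) (X 1 n) ≤ S.form t (x : L2 τ) x := fun t n =>
    S.form_trunc_self_le htr t hx n
  have hqe : ∀ n, ∃ e, Tendsto (fun t : ℝ≥0 => (t : ℝ)⁻¹ * S.form t (X 1 n) (X 1 n)) (𝓝[>] 0)
      (𝓝 e) := fun n => S.exists_tendsto_form_self fun t => (hXX t n).trans (hxE t)
  have hgd : ∀ n, ∃ d, Tendsto (fun t : ℝ≥0 => (t : ℝ)⁻¹ * S.form t (X (1 + γ) n) y) (𝓝[>] 0)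
      (𝓝 d) := fun n => by
    obtain ⟨K, hK, h⟩ := S.exists_form_truncPow_self_le htr hx (r := 1 + γ) (by linarith)
      (by linarith) n
    obtain ⟨K', hK', h'⟩ := S.form_powL2_self_le htr hx (r := 1 - γ) (by linarith) (by linarith)
    exact S.exists_tendsto_form (henergy hK h) (henergy hK' h')
  choose e he using hqe
  choose d hd using hgd
  have hinv : ∀ t : ℝ≥0, (0 : ℝ) ≤ (t : ℝ)⁻¹ := fun t => inv_nonneg.2 t.2
  -- `c = 1 - γ ^ 2 = (2 / q) (2 / q')`
  obtain ⟨G, D, hG, hGD, hdD, hlow, hup⟩ := exists_limit_of_deficit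
    (g := fun t n => (t : ℝ)⁻¹ * S.form t (X (1 + γ) n) y)
    (q := fun t n => (t : ℝ)⁻¹ * S.form t (X 1 n) (X 1 n))
    (Q := fun t => (t : ℝ)⁻¹ * S.form t (x : L2 τ) x) (E := E) (c := 1 - γ ^ 2) (d := d) (e := e)
    (fun t n k hnk => mul_le_mul_of_nonneg_left
      (le_of_tendsto_of_tendsto (hformXy t _) (hformXy t _) <|
        (eventually_ge_atTop k).mono fun m hm => S.form_trunc_mono htr t hb h0 h1 hnk hm) (hinv t))
    (fun t n => mul_le_mul_of_nonneg_left
      (le_of_tendsto_of_tendsto (hformXy t _) (hformX1 t) <|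
        (eventually_ge_atTop n).mono fun m hm => S.form_trunc_le htr t hb h0 h1 hm) (hinv t))
    (fun t n k hnk => by
      rw [← mul_sub, ← mul_sub]
      exact mul_le_mul_of_nonneg_left
        (le_of_tendsto_of_tendsto ((hformXy t _).sub (hformXy t _)) ((hformX1 t).sub_const _) <|
          (eventually_ge_atTop k).mono fun m hm => S.form_sub_form_le htr t hb h0 h1 hnk hm)
        (hinv t))
    (fun t n => by
      rw [mul_left_comm]
      exact mul_le_mul_of_nonneg_left (ge_of_tendsto (hformXy t _) <|
        (eventually_ge_atTop n).mono fun m hm => S.le_form_trunc htr t hb h0 h1 hm) (hinv t))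
    (fun t => (hformX1 t).const_mul _) hQ he
    (fun t n => by
      -- at `t = 0` the left-hand side is `0` because `0⁻¹ = 0`
      rcases eq_zero_or_pos t with rfl | ht
      · have := ge_of_tendsto' (he n) fun s => mul_nonneg (hinv s) (S.form_self_nonneg s _)
        simpa using this
      · rw [inv_mul_le_iff₀ (by exact_mod_cast ht)]
        exact S.form_self_le_of_tendsto (he n) t)
    hd
  have hinner_y : ∀ (t : ℝ≥0) n, ⟪X (1 + γ) n, ((t : ℝ)⁻¹ : ℂ) • (y - S.T2 t y)⟫_ℂ
      = (((t : ℝ)⁻¹ * S.form t (X (1 + γ) n) y : ℝ) : ℂ) := fun t n => by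
    rw [inner_smul_right, S.inner_truncPow_eq_form htr t hx (by linarith) (by linarith)]
    push_cast; rfl
  refine ⟨D, ⟨fun t => G t, fun t _ => ?_, ?_⟩, fun z hz => ?_, ?_, ?_⟩
  · refine ((Complex.continuous_ofReal.tendsto _).comp (hG t)).congr fun n => ?_
    rw [trL2_lmul (isSelfAdjoint_truncPow b _ n)]
    exact (hinner_y t n).symm
  · exact (Complex.continuous_ofReal.tendsto _).comp hGD
  · refine ((Complex.continuous_ofReal.tendsto _).comp hdD).congr fun n => ?_
    rw [trL2_lmul (isSelfAdjoint_truncPow b _ n)]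
    refine tendsto_nhds_unique ((Complex.continuous_ofReal.tendsto _).comp (hd n))
      ((tendsto_const_nhds.inner (S.generator_tendsto z)).congr fun t => ?_)
    rw [hz]
    exact hinner_y t n
  · rw [hEeq, ← Complex.ofReal_mul, Complex.real_le_real]
    nlinarith
  · rw [hEeq, ← Complex.ofReal_mul, Complex.real_le_real]
    have := mul_le_mul_of_nonneg_left hlow hC0
    rwa [← mul_assoc, hconst, one_mul] at this
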